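/- Write $e(t)=e^{2\pi i t}$ and let $$F(x)=\sum_{n=1}^{\infty}\frac{e(n^2x)}{n},$$ where the sum is the limit of the partial sums in their natural order; this series converges for almost every $x\in\mathbb R$, and $F$ is integrable on $[0,1)$. For an irreducible fraction $p/q\in[0,1]$ with $q\ge 1$, written as a finite continued fraction $p/q=[0;a_1,\dots,a_{j_0}]$ with positive integers $a_1,\dots,a_{j_0}$ ($j_0\ge 0$; either of the two expansions, with last quotient equal to $1$ or not, may be chosen), let $I=I_{p/q}$ be the interval of those $x\in[0,1)$ whose continued fraction begins in the same way, $x=[0;a_1,\dots,a_{j_0},\dots]$. Let $|\cdot|$ be Lebesgue measure and $F_I=\frac1{|I|}\int_I F(x)\,dx$. There exists an absolute constant $C>0$ such that for every such $I=I_{p/q}$ (for either choice of the expansion) and every $\lambda>0$, $$\bigl|\{x\in I : |F(x)-F_I|>\lambda\}\bigr|\le C\,|I|\,e^{-\lambda\sqrt{2q}} .$$ -/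

import Mathlib

open Filter Topology MeasureTheory

noncomputable section

/-- The partial sum `∑_{1 ≤ n ≤ N} e(n² x) / n`, where `e(t) = exp(2πit)`. -/
def squaresPartialSum (N : ℕ) (x : ℝ) : ℂ :=
  ∑ n ∈ Finset.Icc 1 N,
    Complex.exp (2 * (Real.pi : ℂ) * Complex.I * ((n : ℂ) ^ 2 * (x : ℂ))) / (n : ℂ)

/-- The (conditionally convergent) Fourier series `F(x) = ∑_{n ≥ 1} e(n² x) / n`: the limit of the
partial sums in their natural order. -/
def squaresSeries (x : ℝ) : ℂ :=
  limUnder atTop (fun N : ℕ => squaresPartialSum N x)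

/-- The value of the finite continued fraction `[0; a₁, …, a_j]`; it is `0` for the empty list. -/
def finContFrac : List ℕ → ℚ
  | [] => 0
  | k :: l => 1 / ((k : ℚ) + finContFrac l)

/-- The interval of all `x ∈ [0,1)` whose regular continued fraction is `[0; a₁, …, a_j, …]`,
that is, whose first `j` partial quotients are `a₁, …, a_j`. -/
def contFracInterval (a : List ℕ) : Set ℝ :=
  {x : ℝ | x ∈ Set.Ico (0 : ℝ) 1 ∧
    ∀ (i : ℕ) (hi : i < a.length), (GenContFract.of x).partDens.get? i = some ((a[i] : ℕ) : ℝ)}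

end

/-! The factor `1/n` is an integral in disguise: `F(x)` is the limit, as `η → 0`, of `thetaMean η x
= ∫_η^∞ √2 (θ(2(x + iv²)) - 1) dv`. Near a rational `p/q`, Poisson summation turns `θ(2(p/q + w))`
into a Gauss sum mod `q` times a multiple of `w^(-1/2)`, plus a small error
(`norm_jacobiTheta_two_mul_rat_add_le`). The normalized Gauss sum is at most `q^(-1/2)` for odd `q`
and `√2 q^(-1/2)` for even `q`; this is `gaussWeight`.

For irrational `x` the integral is cut at the points `1/q_j`, with `q_j` the denominators of the
convergents of `x`. The piece from `1/q_(j+1)` to `1/q_j` is at most `(gaussWeight q_j / 2) log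
a_(j+1) + O(q_j^(-1/2))` (`norm_thetaMean_level_le`). The part `v > 1/q` varies by only
`O(q^(-1/2))` over `I_{p/q}` (`norm_thetaMean_sub_center_le`). With `c = thetaMean (1/q) (p/q)` and
`t ∈ (0,1)` the Möbius coordinate of `x` in `I`, this gives `√(2q) |F(x) - c| ≤ ∑ τ_i log a_(i+1)(t)
+ O(1)`, where `τ_i ≤ √(q/q_i)`, with a further factor `1/√2` when `q_i` is odd. The rate `√(2q)` is
the one that gives an even `q` weight exactly `1`.

Two consecutive denominators are never both even, and they double every two steps. So the weights
decay geometrically and all but one of the first two are at most `3/4`. A single `log a` with weight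
`1` has tail `O(e^(-L))`; the other terms have exponential moments to spare, so the whole sum keeps
the tail `O(e^(-L))` (`exists_volume_digitSum_le`). The Möbius map onto `I` has distortion at most
`4`, which transfers the bound to `I`. Integrating the tail gives `|F_I - c| = O(1/√(2q))`, so
replacing `c` by `F_I` costs a constant factor. -/

/-! ### Quadratic Gauss sums -/

/-- Weyl differencing: after the shift `r = s + h`, the squared modulus is a sum over `h` whose
inner sum over `s` is a complete character sum, vanishing unless `2h = 0`. The 2-torsion count is
what separates odd from even moduli. -/
theorem norm_sq_quadratic_sum_le {R : Type*} [CommRing R] [Fintype R] [DecidableEq R]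
    {ψ : AddChar R ℂ} (hψ : ψ.IsPrimitive) {p : R} (hp : IsUnit p) (m : R) :
    ‖∑ r, ψ (p * r ^ 2 + m * r)‖ ^ 2 ≤
      Fintype.card R * (Finset.univ.filter fun h : R => 2 * h = 0).card := by
  have hconj : ((‖∑ r, ψ (p * r ^ 2 + m * r)‖ ^ 2 : ℝ) : ℂ) =
      ∑ h, ψ (p * h ^ 2 + m * h) * ∑ s, ψ (s * (2 * p * h)) := by
    rw [Complex.ofReal_pow, ← Complex.mul_conj', map_sum, Finset.sum_mul_sum, Finset.sum_comm]
    have : ∀ s : R, ∑ r, ψ (p * r ^ 2 + m * r) * (starRingEnd ℂ) (ψ (p * s ^ 2 + m * s)) =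
        ∑ h, ψ (p * h ^ 2 + m * h) * ψ (s * (2 * p * h)) := by
      intro s
      rw [← Equiv.sum_comp (Equiv.addRight s)]
      refine Finset.sum_congr rfl fun h _ => ?_
      rw [← AddChar.map_neg_eq_conj, ← AddChar.map_add_eq_mul, ← AddChar.map_add_eq_mul]
      congr 1
      simp only [Equiv.coe_addRight]
      ring
    rw [Finset.sum_congr rfl fun s _ => this s, Finset.sum_comm]
    simp_rw [Finset.mul_sum]
  have hb : ‖((‖∑ r, ψ (p * r ^ 2 + m * r)‖ ^ 2 : ℝ) : ℂ)‖ ≤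
      ∑ h : R, if 2 * h = 0 then (Fintype.card R : ℝ) else 0 := by
    rw [hconj]
    refine (norm_sum_le _ _).trans (Finset.sum_le_sum fun h _ => ?_)
    rw [norm_mul, AddChar.norm_apply, one_mul, AddChar.sum_mulShift _ hψ]
    have : 2 * p * h = 0 ↔ 2 * h = 0 := by
      rw [show 2 * p * h = p * (2 * h) by ring, hp.mul_right_eq_zero]
    simp only [this]
    split_ifs <;> simp
  rw [Complex.norm_real, Real.norm_of_nonneg (by positivity), ← Finset.sum_filter,
    Finset.sum_const, nsmul_eq_mul] at hb
  linarith

theorem ZMod.card_two_torsion_le (q : ℕ) [NeZero q] :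
    (Finset.univ.filter fun h : ZMod q => 2 * h = 0).card ≤ 2 := by
  have hmaps : ∀ h ∈ Finset.univ.filter fun h : ZMod q => 2 * h = 0,
      h ∈ ({0, ((q / 2 : ℕ) : ZMod q)} : Finset (ZMod q)) := by
    intro h hh
    simp only [Finset.mem_filter, Finset.mem_univ, true_and] at hh
    have hd : q ∣ 2 * h.val := by
      rw [← ZMod.natCast_eq_zero_iff]
      push_cast
      rw [ZMod.natCast_zmod_val, hh]
    obtain ⟨c, hc⟩ := hd
    have hlt := ZMod.val_lt h
    have hc2 : c < 2 := by
      by_contra hcon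
      have : q * 2 ≤ q * c := Nat.mul_le_mul_left _ (by omega)
      omega
    have hv := ZMod.natCast_zmod_val h
    interval_cases c
    · have : h.val = 0 := by omega
      rw [← hv, this]
      simp only [Nat.cast_zero, Finset.mem_insert, true_or]
    · have : h.val = q / 2 := by omega
      rw [← hv, this]
      simp only [Finset.mem_insert, Finset.mem_singleton, or_true]
  refine (Finset.card_le_card hmaps).trans Finset.card_le_two

theorem ZMod.card_two_torsion_of_odd {q : ℕ} [NeZero q] (hq : Odd q) :
    (Finset.univ.filter fun h : ZMod q => 2 * h = 0).card ≤ 1 := by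
  rw [Finset.card_le_one]
  have hu : IsUnit (2 : ZMod q) := by
    have := (ZMod.isUnit_iff_coprime 2 q).2 hq.coprime_two_left
    simpa using this
  intro a ha b hb
  simp only [Finset.mem_filter, Finset.mem_univ, true_and, hu.mul_right_eq_zero] at ha hb
  rw [ha, hb]

/-- A bound for `|q⁻¹ ∑_{r mod q} e((p r² + m r)/q)|`, depending on the parity of `q`. -/
noncomputable def gaussWeight (q : ℕ) : ℝ := if Odd q then 1 / √q else √2 / √q

theorem gaussWeight_nonneg (q : ℕ) : 0 ≤ gaussWeight q := by
  unfold gaussWeight; split_ifs <;> positivity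

theorem gaussWeight_le (q : ℕ) : gaussWeight q ≤ √2 / √q := by
  unfold gaussWeight
  split_ifs
  · gcongr
    rw [Real.one_le_sqrt]; norm_num
  · rfl

theorem norm_quadratic_gauss_sum_le (q : ℕ) [NeZero q] {p : ZMod q} (hp : IsUnit p) (m : ZMod q) :
    ‖∑ r : ZMod q, ZMod.stdAddChar (p * r ^ 2 + m * r)‖ ≤ q * gaussWeight q := by
  have h := norm_sq_quadratic_sum_le (ZMod.isPrimitive_stdAddChar q) hp m
  rw [ZMod.card] at h
  have hq : (0 : ℝ) < q := by exact_mod_cast Nat.pos_of_ne_zero (NeZero.ne q)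
  refine (sq_le_sq₀ (norm_nonneg _) (mul_nonneg hq.le (gaussWeight_nonneg q))).1 (h.trans ?_)
  rw [mul_pow]
  unfold gaussWeight
  split_ifs with ho
  · have h1 := ZMod.card_two_torsion_of_odd ho
    have h1' : ((Finset.univ.filter fun h : ZMod q => 2 * h = 0).card : ℝ) ≤ 1 := by
      exact_mod_cast h1
    rw [div_pow, Real.sq_sqrt hq.le, show (q : ℝ) ^ 2 * (1 ^ 2 / q) = q * 1 by field_simp]
    gcongr
  · have h1' : ((Finset.univ.filter fun h : ZMod q => 2 * h = 0).card : ℝ) ≤ 2 := by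
      exact_mod_cast ZMod.card_two_torsion_le q
    rw [div_pow, Real.sq_sqrt hq.le, Real.sq_sqrt zero_le_two,
      show (q : ℝ) ^ 2 * (2 / q) = q * 2 by field_simp]
    gcongr

/-! ### The theta function near a rational point -/

theorem tsum_int_eq_sum_tsum_residues {f : ℤ → ℂ} (hf : Summable f) (q : ℕ) [NeZero q] :
    ∑' n, f n = ∑ r : Fin q, ∑' k : ℤ, f (k * q + (r : ℕ)) := by
  have hs : Summable fun x : ℤ × Fin q => f ((Int.divModEquiv q).symm x) :=
    (Equiv.summable_iff _).2 hf
  rw [← (Int.divModEquiv q).symm.tsum_eq f, hs.tsum_prod]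
  simp_rw [tsum_fintype]
  rw [Summable.tsum_finsetSum]
  · rfl
  · intro r _
    exact hs.comp_injective (i := fun k : ℤ => (k, r)) fun a b h => (Prod.ext_iff.1 h).1

/-- On each residue class mod `q` the phase from `p/q` is constant, so the functional equation of
`jacobiTheta₂` (Poisson summation) applies to the class. Collecting the classes for a fixed dual
frequency `m` produces the Gauss sums. -/
theorem jacobiTheta_two_mul_rat_add (p : ℤ) (q : ℕ) [NeZero q] {w : ℂ} (hw : 0 < w.im) :
    jacobiTheta (2 * (p / q + w)) = 1 / (-Complex.I * (2 * q ^ 2 * w)) ^ (1 / 2 : ℂ) *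
      ∑' m : ℤ, (∑ r : Fin q, ZMod.stdAddChar ((p * (r : ℕ) ^ 2 + m * (r : ℕ) : ℤ) : ZMod q)) *
        Complex.exp (Real.pi * Complex.I * m ^ 2 * (-1 / (2 * q ^ 2 * w))) := by
  have hq : (0 : ℝ) < q := by exact_mod_cast Nat.pos_of_ne_zero (NeZero.ne q)
  have hqC : (q : ℂ) ≠ 0 := by exact_mod_cast hq.ne'
  have hw0 : w ≠ 0 := by rintro rfl; simp at hw
  have hτ : 0 < (2 * (q : ℂ) ^ 2 * w).im := by
    rw [show 2 * (q : ℂ) ^ 2 * w = ((2 * q ^ 2 : ℝ) : ℂ) * w by push_cast; ring,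
      Complex.im_ofReal_mul]
    positivity
  have hτ' : 0 < (-1 / (2 * (q : ℂ) ^ 2 * w)).im := by
    rw [neg_div, one_div, Complex.neg_im, Complex.inv_im]
    have : 0 < Complex.normSq (2 * (q : ℂ) ^ 2 * w) := Complex.normSq_pos.2 (by
      rintro h; rw [h] at hτ; simp at hτ)
    rw [neg_div, neg_neg]
    positivity
  have hz : 0 < (2 * ((p : ℂ) / q + w)).im := by
    rw [show 2 * ((p : ℂ) / q + w) = ((2 * (p / q) : ℝ) : ℂ) + ((2 : ℝ) : ℂ) * w by
      push_cast; ring, Complex.add_im, Complex.im_ofReal_mul, Complex.ofReal_im]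
    linarith
  have hs := hasSum_jacobiTheta₂_term 0 hz
  rw [jacobiTheta_eq_jacobiTheta₂, ← hs.tsum_eq, tsum_int_eq_sum_tsum_residues hs.summable q]
  have key : ∀ r : Fin q, ∑' k : ℤ, jacobiTheta₂_term (k * q + (r : ℕ)) 0 (2 * (p / q + w)) =
      1 / (-Complex.I * (2 * q ^ 2 * w)) ^ (1 / 2 : ℂ) *
      ∑' m : ℤ, (ZMod.stdAddChar ((p * (r : ℕ) ^ 2 + m * (r : ℕ) : ℤ) : ZMod q)) *
        Complex.exp (Real.pi * Complex.I * m ^ 2 * (-1 / (2 * q ^ 2 * w))) := by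
    intro r
    have h1 : ∀ k : ℤ, jacobiTheta₂_term (k * q + (r : ℕ)) 0 (2 * (p / q + w)) =
        Complex.exp (2 * Real.pi * Complex.I * (r : ℕ) ^ 2 * (p / q + w)) *
          jacobiTheta₂_term k (2 * (r : ℕ) * q * w) (2 * q ^ 2 * w) := by
      intro k
      rw [jacobiTheta₂_term, jacobiTheta₂_term, ← Complex.exp_add, Complex.exp_eq_exp_iff_exists_int]
      -- This integer is `(p/q)(kq + r)² - (p/q)r²`.
      refine ⟨p * (q * k ^ 2 + 2 * k * (r : ℕ)), ?_⟩
      push_cast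
      field_simp
      ring
    simp_rw [h1]
    rw [tsum_mul_left, (hasSum_jacobiTheta₂_term _ hτ).tsum_eq, jacobiTheta₂_functional_equation,
      ← (hasSum_jacobiTheta₂_term _ hτ').tsum_eq, mul_left_comm, mul_assoc, mul_assoc, ← tsum_mul_left,
      ← tsum_mul_left]
    congr 1
    refine tsum_congr fun m => ?_
    rw [ZMod.stdAddChar_coe, jacobiTheta₂_term, ← Complex.exp_add, ← Complex.exp_add,
      ← Complex.exp_add]
    congr 1
    push_cast
    field_simp
    ring
  rw [Finset.sum_congr rfl fun r _ => key r, ← Finset.mul_sum]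
  congr 1
  simp_rw [Finset.sum_mul]
  rw [Summable.tsum_finsetSum]
  intro r _
  have hs' := (hasSum_jacobiTheta₂_term 0 hτ').summable.norm
  refine Summable.of_norm (hs'.congr fun m => ?_)
  rw [norm_mul, AddChar.norm_apply, one_mul, jacobiTheta₂_term]
  simp

/-- `∑_{m ≠ 0} |m|^{-3/2}` -/
noncomputable def thetaConst : ℝ := ∑' m : ℤ, |(m : ℝ)| ^ (-(3 / 2) : ℝ)

theorem summable_thetaConst : Summable fun m : ℤ => |(m : ℝ)| ^ (-(3 / 2) : ℝ) := by
  exact Real.summable_abs_int_rpow (by norm_num)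

theorem thetaConst_nonneg : 0 ≤ thetaConst := tsum_nonneg fun _ => by positivity

/-- An exponent above `1/2` makes the dual sum over `m ≠ 0` converge; the choice `3/4` makes the
resulting error linear in `q ‖w‖`. -/
theorem exp_neg_le_rpow {t : ℝ} (ht : 0 < t) : Real.exp (-t) ≤ t ^ (-(3 / 4) : ℝ) := by
  have h1 : t ^ (3 / 4 : ℝ) ≤ Real.exp t := by
    rcases le_total t 1 with h | h
    · exact (Real.rpow_le_one ht.le h (by norm_num)).trans (Real.one_le_exp ht.le)
    · calc t ^ (3 / 4 : ℝ) ≤ t ^ (1 : ℝ) := Real.rpow_le_rpow_of_exponent_le h (by norm_num)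
        _ = t := Real.rpow_one t
        _ ≤ Real.exp t := by linarith [Real.add_one_le_exp t]
  rw [Real.exp_neg, Real.rpow_neg ht.le]
  gcongr

theorem exp_neg_mul_sq_le {B : ℝ} (hB : 0 < B) (m : ℤ) :
    Real.exp (-(Real.pi / 2 * m ^ 2 * B)) ≤
      (if m = 0 then 1 else 0) + B ^ (-(3 / 4) : ℝ) * |(m : ℝ)| ^ (-(3 / 2) : ℝ) := by
  split_ifs with h
  · subst h
    have : 0 ≤ B ^ (-(3 / 4) : ℝ) * |((0 : ℤ) : ℝ)| ^ (-(3 / 2) : ℝ) := by positivity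
    simp only [Int.cast_zero] at this ⊢
    norm_num
  · have hm : 0 < |(m : ℝ)| := abs_pos.2 (by exact_mod_cast h)
    have h1 : Real.exp (-(Real.pi / 2 * m ^ 2 * B)) ≤ Real.exp (-(B * |(m : ℝ)| ^ 2)) := by
      rw [Real.exp_le_exp, sq_abs, neg_le_neg_iff]
      have : 1 ≤ Real.pi / 2 := by linarith [Real.pi_gt_three]
      have h2 : 0 ≤ (m : ℝ) ^ 2 * B := by positivity
      nlinarith
    refine h1.trans ((exp_neg_le_rpow (by positivity)).trans_eq ?_)
    rw [Real.mul_rpow hB.le (by positivity), ← Real.rpow_natCast, ← Real.rpow_mul hm.le]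
    norm_num

/-- The first term is the dual frequency `m = 0`. All others are bounded with the same Gauss sum
estimate and the polynomial bound for the exponential, where `B` is the decay rate `Im w / (q‖w‖)²`
of the dual sum. -/
theorem norm_jacobiTheta_two_mul_rat_add_le {p : ℤ} {q : ℕ} (hq0 : 0 < q) (hpq : IsCoprime p q)
    {w : ℂ} (hw : 0 < w.im) :
    ‖jacobiTheta (2 * (p / q + w))‖ ≤ gaussWeight q / √(2 * ‖w‖) +
      thetaConst * (q * ‖w‖ * w.im ^ (-(3 / 4) : ℝ)) := by
  have : NeZero q := ⟨hq0.ne'⟩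
  have hq : (0 : ℝ) < q := by exact_mod_cast hq0
  have hw0 : w ≠ 0 := by rintro rfl; simp at hw
  have hwn : 0 < ‖w‖ := norm_pos_iff.2 hw0
  set B : ℝ := w.im / (q ^ 2 * ‖w‖ ^ 2) with hBdef
  have hB : 0 < B := by positivity
  have hgauss : ∀ m : ℤ, ‖∑ r : Fin q,
      ZMod.stdAddChar ((p * (r : ℕ) ^ 2 + m * (r : ℕ) : ℤ) : ZMod q)‖ ≤ q * gaussWeight q := by
    intro m
    have hu : IsUnit (p : ZMod q) := by
      obtain ⟨a, b, hab⟩ := hpq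
      have h := congrArg (Int.cast : ℤ → ZMod q) hab
      push_cast at h
      rw [ZMod.natCast_self, mul_zero, add_zero] at h
      exact IsUnit.of_mul_eq_one_right _ h
    refine le_trans (le_of_eq ?_) (norm_quadratic_gauss_sum_le q hu m)
    congr 1
    obtain ⟨n, rfl⟩ := Nat.exists_eq_succ_of_ne_zero hq0.ne'
    refine Fintype.sum_equiv (Equiv.refl _) _ _ fun r => ?_
    congr 1
    push_cast
    have : ((r : ℕ) : ZMod n.succ) = r := by
      exact ZMod.natCast_zmod_val (n := n.succ) r
    rw [this]
    rfl
  have hexp : ∀ m : ℤ, ‖Complex.exp (Real.pi * Complex.I * m ^ 2 * (-1 / (2 * q ^ 2 * w)))‖ =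
      Real.exp (-(Real.pi / 2 * m ^ 2 * B)) := by
    intro m
    rw [Complex.norm_exp]
    congr 1
    have : (Real.pi * Complex.I * m ^ 2 * (-1 / (2 * q ^ 2 * w)) : ℂ) =
        ((-(Real.pi * m ^ 2 / (2 * q ^ 2)) : ℝ) : ℂ) * (Complex.I * w⁻¹) := by
      push_cast; field_simp
    rw [this, Complex.re_ofReal_mul, Complex.I_mul_re, Complex.inv_im, Complex.normSq_eq_norm_sq,
      hBdef]
    field_simp
  have hmaj : Summable fun m : ℤ => q * gaussWeight q * ((if m = 0 then (1 : ℝ) else 0) +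
      B ^ (-(3 / 4) : ℝ) * |(m : ℝ)| ^ (-(3 / 2) : ℝ)) :=
    (((hasSum_ite_eq (0 : ℤ) (1 : ℝ)).summable).add (summable_thetaConst.mul_left _)).mul_left _
  have hterm : ∀ m : ℤ, ‖(∑ r : Fin q,
      ZMod.stdAddChar ((p * (r : ℕ) ^ 2 + m * (r : ℕ) : ℤ) : ZMod q)) *
        Complex.exp (Real.pi * Complex.I * m ^ 2 * (-1 / (2 * q ^ 2 * w)))‖ ≤
      q * gaussWeight q * ((if m = 0 then (1 : ℝ) else 0) +
      B ^ (-(3 / 4) : ℝ) * |(m : ℝ)| ^ (-(3 / 2) : ℝ)) := by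
    intro m
    rw [norm_mul, hexp]
    exact mul_le_mul (hgauss m) (exp_neg_mul_sq_le hB m) (Real.exp_pos _).le
      (mul_nonneg hq.le (gaussWeight_nonneg q))
  have hsum := tsum_of_norm_bounded hmaj.hasSum hterm
  rw [tsum_mul_left, Summable.tsum_add (hasSum_ite_eq (0 : ℤ) (1 : ℝ)).summable
    (summable_thetaConst.mul_left _), (hasSum_ite_eq (0 : ℤ) (1 : ℝ)).tsum_eq, tsum_mul_left] at hsum
  have hpre : ‖1 / (-Complex.I * (2 * q ^ 2 * w)) ^ (1 / 2 : ℂ)‖ = 1 / (q * √(2 * ‖w‖)) := by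
    have hne : -Complex.I * (2 * (q : ℂ) ^ 2 * w) ≠ 0 := by
      have : (q : ℂ) ≠ 0 := by exact_mod_cast hq.ne'
      simp [hw0, this]
    rw [norm_div, norm_one, show (1 / 2 : ℂ) = ((1 / 2 : ℝ) : ℂ) by push_cast; rfl,
      Complex.norm_cpow_real, ← Real.sqrt_eq_rpow]
    congr 1
    have : ‖-Complex.I * (2 * (q : ℂ) ^ 2 * w)‖ = q ^ 2 * (2 * ‖w‖) := by
      simp; ring
    rw [this, Real.sqrt_mul (by positivity), Real.sqrt_sq hq.le]
  rw [jacobiTheta_two_mul_rat_add p q hw, norm_mul, hpre]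
  refine (mul_le_mul_of_nonneg_left hsum (by positivity)).trans ?_
  have hsq : 0 < √(2 * ‖w‖) := by positivity
  have hsplit : 1 / (q * √(2 * ‖w‖)) * (q * gaussWeight q * (1 + B ^ (-(3 / 4) : ℝ) * thetaConst)) =
      gaussWeight q / √(2 * ‖w‖) + thetaConst *
        (gaussWeight q / √(2 * ‖w‖) * B ^ (-(3 / 4) : ℝ)) := by
    field_simp
  rw [← thetaConst, hsplit]
  refine add_le_add le_rfl (mul_le_mul_of_nonneg_left ?_ thetaConst_nonneg)
  have hB' : B ^ (-(3 / 4) : ℝ) = q ^ (3 / 2 : ℝ) * ‖w‖ ^ (3 / 2 : ℝ) * w.im ^ (-(3 / 4) : ℝ) := by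
    rw [hBdef, Real.div_rpow hw.le (by positivity), Real.mul_rpow (by positivity) (by positivity),
      ← Real.rpow_natCast, ← Real.rpow_natCast, ← Real.rpow_mul hq.le, ← Real.rpow_mul hwn.le,
      div_eq_mul_inv, mul_inv, ← Real.rpow_neg hq.le, ← Real.rpow_neg hwn.le]
    norm_num
    ring
  have h32 : ∀ x : ℝ, 0 < x → x ^ (3 / 2 : ℝ) = x * √x := by
    intro x hx
    rw [Real.sqrt_eq_rpow, ← Real.rpow_one_add' hx.le (by norm_num)]
    norm_num
  calc gaussWeight q / √(2 * ‖w‖) * B ^ (-(3 / 4) : ℝ)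
      ≤ √2 / √q / √(2 * ‖w‖) * B ^ (-(3 / 4) : ℝ) := by
        gcongr; exact gaussWeight_le q
    _ = q * ‖w‖ * w.im ^ (-(3 / 4) : ℝ) := by
        rw [hB', h32 _ hq, h32 _ hwn, Real.sqrt_mul zero_le_two]
        field_simp

/-! ### Almost everywhere convergence of the series -/

theorem integral_exp_two_pi_int (k : ℤ) :
    ∫ x in (0 : ℝ)..1, Complex.exp (2 * Real.pi * Complex.I * (k * x)) = if k = 0 then 1 else 0 := by
  split_ifs with h
  · simp [h]
  · have hc : 2 * Real.pi * Complex.I * (k : ℂ) ≠ 0 := by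
      have : (k : ℂ) ≠ 0 := by exact_mod_cast h
      simp [this, Real.pi_ne_zero]
    simp_rw [← mul_assoc]
    rw [integral_exp_mul_complex hc]
    have : Complex.exp (2 * Real.pi * Complex.I * k) = 1 :=
      Complex.exp_eq_one_iff.2 ⟨k, by ring⟩
    simp [this]

theorem integral_norm_sq_trig_sum (T : Finset ℕ) (c : ℕ → ℂ) {f : ℕ → ℤ} (hf : Set.InjOn f T) :
    ∫ x in (0 : ℝ)..1, ‖∑ n ∈ T, c n * Complex.exp (2 * Real.pi * Complex.I * (f n * x))‖ ^ 2 =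
      ∑ n ∈ T, ‖c n‖ ^ 2 := by
  have hpt : ∀ x : ℝ, ((‖∑ n ∈ T, c n * Complex.exp (2 * Real.pi * Complex.I * (f n * x))‖ ^ 2 : ℝ)
      : ℂ) = ∑ n ∈ T, ∑ m ∈ T, c n * (starRingEnd ℂ) (c m) *
        Complex.exp (2 * Real.pi * Complex.I * ((f n - f m : ℤ) * x)) := by
    intro x
    rw [Complex.ofReal_pow, ← Complex.mul_conj', map_sum, Finset.sum_mul_sum]
    refine Finset.sum_congr rfl fun n _ => Finset.sum_congr rfl fun m _ => ?_
    rw [map_mul, ← Complex.exp_conj, mul_mul_mul_comm, ← Complex.exp_add]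
    congr 2
    simp [Complex.conj_ofNat]
    ring
  apply Complex.ofReal_injective
  rw [← intervalIntegral.integral_ofReal]
  simp_rw [hpt]
  rw [intervalIntegral.integral_finsetSum fun n _ => Continuous.intervalIntegrable (by fun_prop) _ _]
  push_cast
  refine Finset.sum_congr rfl fun n hn => ?_
  rw [intervalIntegral.integral_finsetSum fun n _ => Continuous.intervalIntegrable (by fun_prop) _ _]
  simp_rw [intervalIntegral.integral_const_mul]
  have hi : ∀ m, ∫ x in (0 : ℝ)..1, Complex.exp (2 * Real.pi * Complex.I * (((f n : ℂ) - f m) * x)) =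
      if f n - f m = 0 then 1 else 0 := by
    intro m
    rw [← integral_exp_two_pi_int]
    push_cast
    rfl
  simp_rw [hi]
  rw [Finset.sum_eq_single n]
  · simp [Complex.mul_conj']
  · intro m hm hmn
    rw [if_neg, mul_zero]
    intro h0
    exact hmn (hf hm hn (by omega))
  · exact fun h => absurd hn h

theorem squaresPartialSum_sub {M N : ℕ} (h : M ≤ N) (x : ℝ) :
    squaresPartialSum N x - squaresPartialSum M x =
      ∑ n ∈ Finset.Ioc M N, ((n : ℂ)⁻¹) *
        Complex.exp (2 * Real.pi * Complex.I * (((n : ℤ) ^ 2 : ℤ) * x)) := by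
  have h1 : ∀ N, squaresPartialSum N x = ∑ n ∈ Finset.Ioc 0 N, ((n : ℂ)⁻¹) *
        Complex.exp (2 * Real.pi * Complex.I * (((n : ℤ) ^ 2 : ℤ) * x)) := by
    intro N
    refine Finset.sum_congr (by ext; simp [Nat.succ_le_iff]) fun n _ => ?_
    push_cast
    ring
  rw [h1, h1, sub_eq_iff_eq_add', Finset.sum_Ioc_consecutive _ (Nat.zero_le _) h]

theorem norm_squaresPartialSum_sub_le {M N : ℕ} (hM : 0 < M) (h : M ≤ N) (x : ℝ) :
    ‖squaresPartialSum N x - squaresPartialSum M x‖ ≤ (N - M) / M := by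
  rw [squaresPartialSum_sub h]
  have hM' : (0 : ℝ) < M := by exact_mod_cast hM
  have hb : ∀ n ∈ Finset.Ioc M N, ‖((n : ℂ)⁻¹) *
        Complex.exp (2 * Real.pi * Complex.I * (((n : ℤ) ^ 2 : ℤ) * x))‖ ≤ 1 / M := by
    intro n hn
    have hMn : (M : ℝ) ≤ n := by exact_mod_cast (Finset.mem_Ioc.1 hn).1.le
    have : ‖Complex.exp (2 * Real.pi * Complex.I * (((n : ℤ) ^ 2 : ℤ) * x))‖ = 1 := by
      rw [show 2 * Real.pi * Complex.I * (((n : ℤ) ^ 2 : ℤ) * x) =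
        ((2 * Real.pi * (n ^ 2 * x) : ℝ) : ℂ) * Complex.I by push_cast; ring,
        Complex.norm_exp_ofReal_mul_I]
    rw [norm_mul, this, mul_one, norm_inv, Complex.norm_natCast, ← one_div]
    gcongr
  refine (norm_sum_le_of_le _ hb).trans_eq ?_
  rw [Finset.sum_const, Nat.card_Ioc, nsmul_eq_mul, Nat.cast_sub h]
  ring

theorem continuous_squaresPartialSum (N : ℕ) : Continuous (squaresPartialSum N) := by
  unfold squaresPartialSum
  fun_prop

theorem cube_gap_le (k : ℕ) :
    (((k + 2 : ℕ) ^ 3 : ℕ) : ℝ) - ((k + 1 : ℕ) ^ 3 : ℕ) ≤ 7 * ((k : ℝ) + 1) ^ 2 := by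
  push_cast
  have : (0 : ℝ) ≤ k := k.cast_nonneg
  nlinarith

/-- The squares `n²` are distinct, so orthogonality gives the `L²` norm of a block between
consecutive cubes: about `k²` terms of squared size `k^(-6)`. A weighted `d ≤ (K^(-2) + K²d²)/2`
with `K = k + 1` passes to the `L¹` norm, which is summable in `k`. -/
theorem integral_norm_cube_block_le (k : ℕ) :
    ∫ x in (0 : ℝ)..1, ‖squaresPartialSum ((k + 2) ^ 3) x - squaresPartialSum ((k + 1) ^ 3) x‖ ≤
      4 / ((k : ℝ) + 1) ^ 2 := by
  have hk : (0 : ℝ) < (k : ℝ) + 1 := by positivity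
  have hle : (k + 1) ^ 3 ≤ (k + 2) ^ 3 := Nat.pow_le_pow_left (by omega) 3
  have hsq : ∫ x in (0 : ℝ)..1,
      ‖squaresPartialSum ((k + 2) ^ 3) x - squaresPartialSum ((k + 1) ^ 3) x‖ ^ 2 ≤
        7 / ((k : ℝ) + 1) ^ 4 := by
    simp_rw [squaresPartialSum_sub hle]
    rw [integral_norm_sq_trig_sum _ (fun n => (n : ℂ)⁻¹) (f := fun n => (n : ℤ) ^ 2)
      (by
        intro a _ b _ hab
        have : a ^ 2 = b ^ 2 := by
          simp only at hab
          exact_mod_cast hab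
        exact Nat.pow_left_injective (n := 2) (by norm_num) this)]
    have hb : ∀ n : ℕ, n ∈ Finset.Ioc ((k + 1) ^ 3) ((k + 2) ^ 3) → ‖(n : ℂ)⁻¹‖ ^ 2 ≤
        1 / ((k : ℝ) + 1) ^ 6 := by
      intro n hn
      have hMn : ((k : ℝ) + 1) ^ 3 ≤ n := by exact_mod_cast (Finset.mem_Ioc.1 hn).1.le
      rw [norm_inv, Complex.norm_natCast, inv_pow, ← one_div,
        show ((k : ℝ) + 1) ^ 6 = (((k : ℝ) + 1) ^ 3) ^ 2 by ring]
      gcongr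
    refine (Finset.sum_le_sum fun n hn => hb n hn).trans ?_
    rw [Finset.sum_const, Nat.card_Ioc, nsmul_eq_mul, Nat.cast_sub hle]
    calc _ ≤ 7 * ((k : ℝ) + 1) ^ 2 * (1 / ((k : ℝ) + 1) ^ 6) := by
          gcongr; exact cube_gap_le k
      _ = 7 / ((k : ℝ) + 1) ^ 4 := by field_simp
  have c1 : Continuous fun x =>
      squaresPartialSum ((k + 2) ^ 3) x - squaresPartialSum ((k + 1) ^ 3) x :=
    (continuous_squaresPartialSum _).sub (continuous_squaresPartialSum _)
  have c2 : Continuous fun x => ((k : ℝ) + 1) ^ 2 / 2 *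
      ‖squaresPartialSum ((k + 2) ^ 3) x - squaresPartialSum ((k + 1) ^ 3) x‖ ^ 2 :=
    continuous_const.mul (c1.norm.pow 2)
  calc ∫ x in (0 : ℝ)..1, ‖squaresPartialSum ((k + 2) ^ 3) x - squaresPartialSum ((k + 1) ^ 3) x‖
      ≤ ∫ x in (0 : ℝ)..1, (1 / (2 * ((k : ℝ) + 1) ^ 2) + ((k : ℝ) + 1) ^ 2 / 2 *
        ‖squaresPartialSum ((k + 2) ^ 3) x - squaresPartialSum ((k + 1) ^ 3) x‖ ^ 2) := by
        refine intervalIntegral.integral_mono_on zero_le_one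
          (c1.norm.intervalIntegrable _ _)
          ((continuous_const.add c2).intervalIntegrable _ _)
          fun x _ => ?_
        set d := ‖squaresPartialSum ((k + 2) ^ 3) x - squaresPartialSum ((k + 1) ^ 3) x‖
        have : 1 / (2 * ((k : ℝ) + 1) ^ 2) + ((k : ℝ) + 1) ^ 2 / 2 * d ^ 2 - d =
          (1 / ((k : ℝ) + 1) - ((k : ℝ) + 1) * d) ^ 2 / 2 := by field_simp; ring
        have h2 := sq_nonneg (1 / ((k : ℝ) + 1) - ((k : ℝ) + 1) * d)
        linarith
    _ = 1 / (2 * ((k : ℝ) + 1) ^ 2) + ((k : ℝ) + 1) ^ 2 / 2 * ∫ x in (0 : ℝ)..1,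
        ‖squaresPartialSum ((k + 2) ^ 3) x - squaresPartialSum ((k + 1) ^ 3) x‖ ^ 2 := by
        rw [intervalIntegral.integral_add (by simp) (c2.intervalIntegrable _ _),
          intervalIntegral.integral_const_mul]
        simp
    _ ≤ 1 / (2 * ((k : ℝ) + 1) ^ 2) + ((k : ℝ) + 1) ^ 2 / 2 * (7 / ((k : ℝ) + 1) ^ 4) := by
        gcongr
    _ = 4 / ((k : ℝ) + 1) ^ 2 := by field_simp; ring

/-- Between consecutive cubes the trivial bound on the partial sums is `O(1/k)`, so cubes are dense
enough to control the full sequence. -/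
theorem tendsto_of_cube_subsequence {x : ℝ} {s : ℂ}
    (h : Tendsto (fun k : ℕ => squaresPartialSum ((k + 1) ^ 3) x) atTop (𝓝 s)) :
    Tendsto (fun N => squaresPartialSum N x) atTop (𝓝 s) := by
  rw [Metric.tendsto_atTop] at h ⊢
  intro ε hε
  obtain ⟨K, hK⟩ := h (ε / 2) (by positivity)
  obtain ⟨K', hK'⟩ := exists_nat_gt (14 / ε)
  refine ⟨(max K K' + 1) ^ 3, fun N hN => ?_⟩
  have hex : ∃ k, max K K' ≤ k ∧ (k + 1) ^ 3 ≤ N ∧ N < (k + 2) ^ 3 := by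
    have hP : (max K K' + 1) ^ 3 ≤ N := hN
    have hbound : max K K' ≤ N := by
      have := Nat.le_self_pow (n := 3) (by norm_num) (max K K' + 1)
      omega
    refine ⟨Nat.findGreatest (fun k => (k + 1) ^ 3 ≤ N) N, Nat.le_findGreatest hbound hP,
      Nat.findGreatest_spec (P := fun k => (k + 1) ^ 3 ≤ N) hbound hP, ?_⟩
    by_contra hcon
    have hcon' : (Nat.findGreatest (fun k => (k + 1) ^ 3 ≤ N) N + 1 + 1) ^ 3 ≤ N := by
      push Not at hcon; exact hcon
    have hle : Nat.findGreatest (fun k => (k + 1) ^ 3 ≤ N) N + 1 ≤ N := by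
      have := Nat.le_self_pow (n := 3) (by norm_num)
        (Nat.findGreatest (fun k => (k + 1) ^ 3 ≤ N) N + 1 + 1)
      omega
    have := Nat.le_findGreatest (P := fun k => (k + 1) ^ 3 ≤ N) hle hcon'
    omega
  obtain ⟨k, hk, h1, h2⟩ := hex
  have ha := hK k ((le_max_left _ _).trans hk)
  have hb := norm_squaresPartialSum_sub_le (by positivity) h1 x
  have hkK : (K' : ℝ) ≤ k := by exact_mod_cast (le_max_right _ _).trans hk
  have hk0 : (0 : ℝ) < (k : ℝ) + 1 := by positivity
  have hb' : ((N : ℝ) - ((k + 1) ^ 3 : ℕ)) / ((k + 1) ^ 3 : ℕ) ≤ 7 / ((k : ℝ) + 1) := by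
    have hN2 : (N : ℝ) ≤ ((k + 2) ^ 3 : ℕ) := by exact_mod_cast h2.le
    calc ((N : ℝ) - ((k + 1) ^ 3 : ℕ)) / ((k + 1) ^ 3 : ℕ)
        ≤ (7 * ((k : ℝ) + 1) ^ 2) / ((k + 1) ^ 3 : ℕ) := by
          gcongr; exact (sub_le_sub_right hN2 _).trans (cube_gap_le k)
      _ = 7 / ((k : ℝ) + 1) := by push_cast; field_simp
  have hc : 7 / ((k : ℝ) + 1) < ε / 2 := by
    rw [div_lt_iff₀ hk0]
    rw [div_lt_iff₀ hε] at hK'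
    nlinarith
  calc dist (squaresPartialSum N x) s ≤ dist (squaresPartialSum N x)
        (squaresPartialSum ((k + 1) ^ 3) x) + dist (squaresPartialSum ((k + 1) ^ 3) x) s :=
        dist_triangle _ _ _
    _ < ε / 2 + ε / 2 := by
        refine add_lt_add_of_le_of_lt ?_ ha
        rw [dist_eq_norm]
        exact (hb.trans hb').trans hc.le
    _ = ε := by ring

theorem ae_Ioc_exists_tendsto_squaresPartialSum :
    ∀ᵐ x ∂(volume.restrict (Set.Ioc (0 : ℝ) 1)),
      ∃ s : ℂ, Tendsto (fun N : ℕ => squaresPartialSum N x) atTop (𝓝 s) := by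
  set D : ℕ → ℝ → ℂ := fun k x => squaresPartialSum ((k + 2) ^ 3) x - squaresPartialSum ((k + 1) ^ 3) x
    with hD
  have hDc : ∀ k, Continuous (D k) := fun k => (continuous_squaresPartialSum _).sub
    (continuous_squaresPartialSum _)
  have hsum : ∫⁻ x in Set.Ioc (0 : ℝ) 1, ∑' k, ‖D k x‖ₑ ≠ ⊤ := by
    rw [lintegral_tsum fun k => (hDc k).enorm.measurable.aemeasurable]
    have hk : ∀ k, ∫⁻ x in Set.Ioc (0 : ℝ) 1, ‖D k x‖ₑ ≤ ENNReal.ofReal (4 / ((k : ℝ) + 1) ^ 2) := by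
      intro k
      have hint : IntegrableOn (D k) (Set.Ioc 0 1) :=
        ((hDc k).continuousOn.integrableOn_Icc).mono_set Set.Ioc_subset_Icc_self
      rw [← ofReal_integral_norm_eq_lintegral_enorm hint]
      apply ENNReal.ofReal_le_ofReal
      rw [← intervalIntegral.integral_of_le zero_le_one]
      exact integral_norm_cube_block_le k
    refine ne_top_of_le_ne_top ?_ (ENNReal.tsum_le_tsum hk)
    rw [← ENNReal.ofReal_tsum_of_nonneg (fun k => by positivity)]
    · exact ENNReal.ofReal_ne_top
    · have := (summable_nat_add_iff 1).2 (Real.summable_one_div_nat_pow.2 one_lt_two)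
      simpa [div_eq_mul_inv] using this.mul_left 4
  have hae := ae_lt_top' (AEMeasurable.tsum fun k => (hDc k).enorm.measurable.aemeasurable)
    hsum
  filter_upwards [hae] with x hx
  have hs : Summable fun k => D k x := by
    refine Summable.of_norm ?_
    have : Summable fun k => ‖D k x‖₊ := ENNReal.tsum_coe_ne_top_iff_summable.1 hx.ne
    exact NNReal.summable_coe.2 this
  refine ⟨squaresPartialSum 1 x + ∑' k, D k x, tendsto_of_cube_subsequence ?_⟩
  have ht := (hs.hasSum.tendsto_sum_nat).const_add (squaresPartialSum 1 x)
  refine ht.congr fun k => ?_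
  have := Finset.sum_range_sub (fun k => squaresPartialSum ((k + 1) ^ 3) x) k
  simp only [hD]
  rw [show (∑ i ∈ Finset.range k, (squaresPartialSum ((i + 2) ^ 3) x -
    squaresPartialSum ((i + 1) ^ 3) x)) = _ from this]
  simp

theorem squaresPartialSum_sub_int (N : ℕ) (x : ℝ) (j : ℤ) :
    squaresPartialSum N (x - j) = squaresPartialSum N x := by
  unfold squaresPartialSum
  refine Finset.sum_congr rfl fun n _ => ?_
  congr 1
  rw [Complex.exp_eq_exp_iff_exists_int]
  refine ⟨-(n ^ 2 * j), ?_⟩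
  push_cast
  ring

theorem ae_exists_tendsto_squaresPartialSum :
    ∀ᵐ x : ℝ, ∃ s : ℂ, Tendsto (fun N : ℕ => squaresPartialSum N x) atTop (𝓝 s) := by
  have h := ae_Ioc_exists_tendsto_squaresPartialSum
  rw [ae_restrict_iff' measurableSet_Ioc, ae_iff] at h
  rw [ae_iff]
  refine measure_mono_null (t := ⋃ j : ℤ, (fun x : ℝ => x + (-j : ℤ)) ⁻¹'
    {a : ℝ | ¬(a ∈ Set.Ioc (0 : ℝ) 1 →
      ∃ s : ℂ, Tendsto (fun N : ℕ => squaresPartialSum N a) atTop (𝓝 s))}) ?_ ?_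
  · intro x hx
    rw [Set.mem_iUnion]
    -- The ceiling, not the floor: the fundamental domain is `(0,1]`.
    refine ⟨⌈x⌉ - 1, ?_⟩
    have hx' : x + (-(⌈x⌉ - 1) : ℤ) = x - (⌈x⌉ - 1 : ℤ) := by push_cast; ring
    simp only [Set.mem_preimage, Set.mem_ofPred_eq, hx', squaresPartialSum_sub_int]
    simp only [Set.mem_ofPred_eq] at hx
    rw [Classical.not_imp]
    refine ⟨⟨?_, ?_⟩, hx⟩
    · push_cast; linarith [Int.ceil_lt_add_one x]
    · push_cast; linarith [Int.le_ceil x]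
  · refine measure_iUnion_null fun j => ?_
    rw [measure_preimage_add_right]
    exact h

/-! ### The series as a limit of theta integrals -/

theorem norm_sum_mul_antitone_le {c : ℕ → ℂ} {b : ℕ → ℝ} {D : ℝ} (hb : Antitone b)
    (hb0 : ∀ n, 0 ≤ b n) (hD : ∀ m, ‖∑ i ∈ Finset.range m, c i‖ ≤ D) (m : ℕ) :
    ‖∑ i ∈ Finset.range m, c i * b i‖ ≤ D * b 0 := by
  have hD0 : 0 ≤ D := (norm_nonneg _).trans (hD 0)
  rcases m with _ | m
  · simpa using mul_nonneg hD0 (hb0 0)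
  have hparts := Finset.sum_range_by_parts b c (m + 1)
  have : ∑ i ∈ Finset.range (m + 1), c i * b i = ∑ i ∈ Finset.range (m + 1), b i • c i :=
    Finset.sum_congr rfl fun i _ => by rw [Complex.real_smul, mul_comm]
  rw [this, hparts, Nat.add_sub_cancel]
  have h2 : ‖∑ i ∈ Finset.range m, (b (i + 1) - b i) • ∑ j ∈ Finset.range (i + 1), c j‖ ≤
      ∑ i ∈ Finset.range m, (b i - b (i + 1)) * D := by
    refine norm_sum_le_of_le _ fun i _ => ?_
    rw [norm_smul, Real.norm_eq_abs, abs_sub_comm, abs_of_nonneg (sub_nonneg.2 (hb (Nat.le_succ i)))]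
    exact mul_le_mul_of_nonneg_left (hD _) (sub_nonneg.2 (hb (Nat.le_succ i)))
  rw [← Finset.sum_mul, Finset.sum_range_sub'] at h2
  have h1 : ‖b m • ∑ i ∈ Finset.range (m + 1), c i‖ ≤ b m * D := by
    rw [norm_smul, Real.norm_eq_abs, abs_of_nonneg (hb0 m)]
    exact mul_le_mul_of_nonneg_left (hD _) (hb0 m)
  refine (norm_sub_le _ _).trans ((add_le_add h1 h2).trans_eq ?_)
  ring

/-- Summation by weights that decrease along the series and tend to `1` is regular. -/
theorem tendsto_weighted_sum {ι : Type*} {l : Filter ι} {c : ℕ → ℂ} {s : ℂ}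
    (hc : Tendsto (fun N => ∑ i ∈ Finset.range N, c i) atTop (𝓝 s)) {w : ι → ℕ → ℝ} {Φ : ι → ℂ}
    (hanti : ∀ᶠ j in l, Antitone (w j)) (h0 : ∀ᶠ j in l, ∀ n, 0 ≤ w j n)
    (h1 : ∀ᶠ j in l, ∀ n, w j n ≤ 1) (hlim : ∀ n, Tendsto (fun j => w j n) l (𝓝 1))
    (hsum : ∀ᶠ j in l, HasSum (fun n => c n * w j n) (Φ j)) : Tendsto Φ l (𝓝 s) := by
  rw [Metric.tendsto_nhds]
  intro ε hε
  obtain ⟨N, hN⟩ := Metric.tendsto_atTop.1 hc (ε / 8) (by positivity)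
  have hfin : Tendsto (fun j => ∑ i ∈ Finset.range N, c i * (w j i : ℂ)) l
      (𝓝 (∑ i ∈ Finset.range N, c i)) := by
    refine tendsto_finsetSum _ fun i _ => ?_
    have := ((Complex.continuous_ofReal.tendsto 1).comp (hlim i)).const_mul (c i)
    simpa using this
  have hfin' := (Metric.tendsto_nhds.1 hfin) (ε / 4) (by positivity)
  filter_upwards [hanti, h0, h1, hsum, hfin'] with j ha hj0 hj1 hs hf
  -- Cauchy's criterion makes every unweighted block past `N` small; Abel summation keeps this under
  -- the weights, uniformly in `j`.
  have hblock : ∀ m, ‖∑ i ∈ Finset.range m, c (N + i) * (w j (N + i) : ℂ)‖ ≤ ε / 4 := by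
    intro m
    have hD : ∀ m, ‖∑ i ∈ Finset.range m, c (N + i)‖ ≤ ε / 4 := by
      intro m
      have hsplit := Finset.sum_range_add c N m
      have e : ∑ i ∈ Finset.range m, c (N + i) =
        (∑ i ∈ Finset.range (N + m), c i - s) - (∑ i ∈ Finset.range N, c i - s) := by
        rw [hsplit]; ring
      rw [e]
      have ha := hN (N + m) (by omega)
      have hb := hN N le_rfl
      rw [dist_eq_norm] at ha hb
      linarith [norm_sub_le (∑ i ∈ Finset.range (N + m), c i - s) (∑ i ∈ Finset.range N, c i - s)]
    refine (norm_sum_mul_antitone_le (b := fun i => w j (N + i)) (fun a b h => ha (by omega))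
      (fun n => hj0 _) hD m).trans ?_
    have := hj1 (N + 0)
    nlinarith
  have htail : ‖Φ j - ∑ i ∈ Finset.range N, c i * (w j i : ℂ)‖ ≤ ε / 4 := by
    have ht := hs.tendsto_sum_nat.comp (tendsto_add_atTop_nat N)
    have ht' := (ht.sub_const (∑ i ∈ Finset.range N, c i * (w j i : ℂ))).norm
    refine le_of_tendsto ht' (Eventually.of_forall fun m => ?_)
    have := hblock m
    simp only [Function.comp]
    rw [add_comm m N, Finset.sum_range_add, add_sub_cancel_left]
    exact this
  have hNs := hN N le_rfl
  rw [dist_eq_norm] at *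
  calc ‖Φ j - s‖ = ‖(Φ j - ∑ i ∈ Finset.range N, c i * (w j i : ℂ)) +
        (∑ i ∈ Finset.range N, c i * (w j i : ℂ) - ∑ i ∈ Finset.range N, c i) +
        (∑ i ∈ Finset.range N, c i - s)‖ := by congr 1; ring
    _ ≤ _ := norm_add₃_le
    _ < ε := by linarith

/-- The Gaussian tail `∫_u^∞ 2√2 exp(-2πt²) dt`. -/
noncomputable def gaussTail (u : ℝ) : ℝ := ∫ t in Set.Ioi u, 2 * √2 * Real.exp (-(2 * Real.pi) * t ^ 2)

theorem integrable_gaussTail : Integrable fun t : ℝ => 2 * √2 * Real.exp (-(2 * Real.pi) * t ^ 2) :=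
  (integrable_exp_neg_mul_sq (by positivity)).const_mul _

theorem gaussTail_nonneg (u : ℝ) : 0 ≤ gaussTail u :=
  setIntegral_nonneg measurableSet_Ioi fun _ _ => by positivity

theorem gaussTail_antitone : Antitone gaussTail := fun _ _ h =>
  setIntegral_mono_set integrable_gaussTail.integrableOn
    (Eventually.of_forall fun t => by
      change 0 ≤ 2 * √2 * Real.exp (-(2 * Real.pi) * t ^ 2)
      positivity)
    (Eventually.of_forall (Set.Ioi_subset_Ioi h))

theorem gaussTail_zero : gaussTail 0 = 1 := by
  unfold gaussTail
  rw [integral_const_mul, integral_gaussian_Ioi,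
    show Real.pi / (2 * Real.pi) = 2⁻¹ by field_simp, Real.sqrt_inv]
  field_simp

theorem one_sub_le_gaussTail {u : ℝ} (hu : 0 ≤ u) : 1 - 2 * √2 * u ≤ gaussTail u := by
  have hsplit : gaussTail 0 = (∫ t in Set.Ioc 0 u, 2 * √2 * Real.exp (-(2 * Real.pi) * t ^ 2)) +
      gaussTail u := by
    unfold gaussTail
    rw [← setIntegral_union Set.Ioc_disjoint_Ioi_same measurableSet_Ioi
      integrable_gaussTail.integrableOn integrable_gaussTail.integrableOn,
      Set.Ioc_union_Ioi_eq_Ioi hu]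
  have hle : ∫ t in Set.Ioc 0 u, 2 * √2 * Real.exp (-(2 * Real.pi) * t ^ 2) ≤
      ∫ _ in Set.Ioc 0 u, 2 * √2 := by
    refine setIntegral_mono integrable_gaussTail.integrableOn (integrable_const _) fun t => ?_
    have : Real.exp (-(2 * Real.pi) * t ^ 2) ≤ 1 := by
      rw [Real.exp_le_one_iff]
      have : 0 ≤ 2 * Real.pi * t ^ 2 := by positivity
      linarith
    have h2 : 0 ≤ 2 * √2 := by positivity
    simp only
    nlinarith
  rw [setIntegral_const, Measure.real, Real.volume_Ioc, sub_zero, ENNReal.toReal_ofReal hu,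
    smul_eq_mul] at hle
  rw [gaussTail_zero] at hsplit
  linarith

/-- The smoothed series `∑ e(n²x)/n · gaussTail (n η)`, as an integral of the theta function over a
vertical half-line. -/
noncomputable def thetaMean (η x : ℝ) : ℂ :=
  ∫ v in Set.Ioi η, (√2 : ℂ) * (jacobiTheta (2 * (x + (v ^ 2 : ℝ) * Complex.I)) - 1)

/-- Expand `θ(2z) - 1 = 2 ∑ e(n²z)` and integrate termwise; the substitution `t = nv` in each
Gaussian yields both the coefficient `1/n` and the smoothing factor. -/
theorem hasSum_thetaMean {η : ℝ} (hη : 0 < η) (x : ℝ) :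
    HasSum (fun n : ℕ => Complex.exp (2 * (Real.pi : ℂ) * Complex.I *
      (((n + 1 : ℕ) : ℂ) ^ 2 * (x : ℂ))) / ((n + 1 : ℕ) : ℂ) * (gaussTail ((n + 1) * η) : ℂ))
      (thetaMean η x) := by
  set F : ℕ → ℝ → ℂ := fun n v => Complex.exp (2 * (Real.pi : ℂ) * Complex.I *
      (((n + 1 : ℕ) : ℂ) ^ 2 * (x : ℂ))) *
      ((2 * √2 * Real.exp (-(2 * Real.pi) * ((n + 1) * v) ^ 2) : ℝ) : ℂ) with hF
  have hunit : ∀ n : ℕ, ‖Complex.exp (2 * (Real.pi : ℂ) * Complex.I *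
      (((n + 1 : ℕ) : ℂ) ^ 2 * (x : ℂ)))‖ = 1 := by
    intro n
    rw [show 2 * (Real.pi : ℂ) * Complex.I * (((n + 1 : ℕ) : ℂ) ^ 2 * (x : ℂ)) =
      ((2 * Real.pi * (((n + 1 : ℕ) : ℝ) ^ 2 * x) : ℝ) : ℂ) * Complex.I by push_cast; ring,
      Complex.norm_exp_ofReal_mul_I]
  have hpos : ∀ n : ℕ, (0 : ℝ) < (n : ℝ) + 1 := fun n => by positivity
  have hreal : ∀ n : ℕ, Integrable fun v : ℝ =>
      2 * √2 * Real.exp (-(2 * Real.pi) * (((n : ℝ) + 1) * v) ^ 2) := fun n =>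
    (integrable_comp_mul_left_iff _ (hpos n).ne').2 integrable_gaussTail
  have hFint : ∀ n, Integrable (F n) (volume.restrict (Set.Ioi η)) := fun n =>
    ((hreal n).ofReal.const_mul _).integrableOn
  have hFnorm : ∀ n v, ‖F n v‖ = 2 * √2 * Real.exp (-(2 * Real.pi) * (((n : ℝ) + 1) * v) ^ 2) := by
    intro n v
    rw [hF]
    simp only
    rw [norm_mul, hunit, one_mul, Complex.norm_real, Real.norm_of_nonneg (by positivity)]
  have hsumm : Summable fun n => ∫ v in Set.Ioi η, ‖F n v‖ := by
    have hgeo : Summable fun n : ℕ => Real.exp (-(Real.pi * η ^ 2)) ^ n :=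
      summable_geometric_of_lt_one (Real.exp_pos _).le (by
        rw [Real.exp_lt_one_iff]
        have : 0 < Real.pi * η ^ 2 := by positivity
        linarith)
    refine Summable.of_nonneg_of_le (fun n => integral_nonneg fun v => norm_nonneg _) (fun n => ?_)
      -- For `v > η` one has `2(n+1)²v² ≥ nη² + v²`, which separates a geometric factor in `n` from
      -- an integrable function of `v`.
      (hgeo.mul_right (∫ v in Set.Ioi η, 2 * √2 * Real.exp (-Real.pi * v ^ 2)))
    rw [← integral_const_mul]
    refine setIntegral_mono_on (hFint n).norm
      (((integrable_exp_neg_mul_sq Real.pi_pos).const_mul _).const_mul _).integrableOn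
      measurableSet_Ioi fun v hv => ?_
    rw [hFnorm, ← Real.exp_nat_mul, mul_left_comm, ← Real.exp_add]
    gcongr
    have hv' : η < v := hv
    have h1 : η ^ 2 ≤ v ^ 2 := by gcongr
    have hn : (0 : ℝ) ≤ n := n.cast_nonneg
    have h3 : (n : ℝ) * η ^ 2 + v ^ 2 ≤ 2 * (((n : ℝ) + 1) * v) ^ 2 := by
      have : (0 : ℝ) ≤ v ^ 2 := by positivity
      nlinarith [mul_nonneg hn (sub_nonneg.2 h1), mul_nonneg hn this, mul_nonneg hn (mul_nonneg hn this)]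
    have := mul_le_mul_of_nonneg_left h3 Real.pi_pos.le
    nlinarith
  have hmain := hasSum_integral_of_summable_integral_norm hFint hsumm
  have hterm : ∀ n : ℕ, ∫ v in Set.Ioi η, F n v = Complex.exp (2 * (Real.pi : ℂ) * Complex.I *
      (((n + 1 : ℕ) : ℂ) ^ 2 * (x : ℂ))) / ((n + 1 : ℕ) : ℂ) * (gaussTail ((n + 1) * η) : ℂ) := by
    intro n
    rw [hF]
    simp only
    rw [integral_const_mul, integral_complex_ofReal,
      integral_comp_mul_left_Ioi (fun t => 2 * √2 * Real.exp (-(2 * Real.pi) * t ^ 2)) η (hpos n),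
      ← gaussTail]
    push_cast
    rw [smul_eq_mul]
    push_cast
    field_simp
  have htot : ∫ v in Set.Ioi η, ∑' n, F n v = thetaMean η x := by
    unfold thetaMean
    refine setIntegral_congr_fun measurableSet_Ioi fun v hv => ?_
    have hv0 : 0 < v := hη.trans hv
    have him : 0 < (2 * ((x : ℂ) + (v ^ 2 : ℝ) * Complex.I)).im := by
      have : (2 * ((x : ℂ) + (v ^ 2 : ℝ) * Complex.I)).im = 2 * v ^ 2 := by
        simp [-Complex.ofReal_pow]
      rw [this]; positivity
    have hs := (hasSum_nat_jacobiTheta him).mul_left (2 * √2 : ℂ)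
    have : HasSum (fun n => F n v) ((√2 : ℂ) * (jacobiTheta (2 * (x + (v ^ 2 : ℝ) * Complex.I)) - 1)) := by
      rw [show (√2 : ℂ) * (jacobiTheta (2 * (x + (v ^ 2 : ℝ) * Complex.I)) - 1) =
        2 * √2 * ((jacobiTheta (2 * (x + (v ^ 2 : ℝ) * Complex.I)) - 1) / 2) by ring]
      refine hs.congr_fun fun n => ?_
      rw [hF]
      simp only
      push_cast
      rw [mul_left_comm, ← Complex.exp_add]
      congr 2
      linear_combination (-2 * Real.pi * ((n : ℂ) + 1) ^ 2 * v ^ 2) * Complex.I_sq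
    exact this.tsum_eq
  rw [htot] at hmain
  exact hmain.congr_fun fun n => (hterm n).symm

theorem tendsto_thetaMean {x : ℝ} {s : ℂ}
    (h : Tendsto (fun N => squaresPartialSum N x) atTop (𝓝 s)) :
    Tendsto (fun η => thetaMean η x) (𝓝[>] 0) (𝓝 s) := by
  have hpos : ∀ᶠ η : ℝ in 𝓝[>] 0, 0 < η := eventually_mem_nhdsWithin
  refine tendsto_weighted_sum (c := fun n : ℕ => Complex.exp (2 * (Real.pi : ℂ) * Complex.I *
      (((n + 1 : ℕ) : ℂ) ^ 2 * (x : ℂ))) / ((n + 1 : ℕ) : ℂ))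
      (w := fun η n => gaussTail ((n + 1) * η)) ?_ ?_ ?_ ?_ ?_ ?_
  · refine h.congr fun N => ?_
    unfold squaresPartialSum
    rw [Finset.range_eq_Ico, Finset.sum_Ico_add' (fun n : ℕ => Complex.exp (2 * (Real.pi : ℂ) *
      Complex.I * ((n : ℂ) ^ 2 * (x : ℂ))) / (n : ℂ)) 0 N 1]
    rfl
  · filter_upwards [hpos] with η hη
    intro a b hab
    apply gaussTail_antitone
    gcongr
  · exact Eventually.of_forall fun η n => gaussTail_nonneg _
  · filter_upwards [hpos] with η hη n
    exact (gaussTail_antitone (mul_nonneg (by positivity) hη.le)).trans_eq gaussTail_zero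
  · intro n
    have hl : Tendsto (fun η : ℝ => 1 - 2 * √2 * (((n : ℝ) + 1) * η)) (𝓝[>] 0) (𝓝 1) := by
      have : Continuous fun η : ℝ => 1 - 2 * √2 * (((n : ℝ) + 1) * η) := by fun_prop
      have := this.tendsto 0
      simp only [mul_zero, sub_zero] at this
      exact this.mono_left nhdsWithin_le_nhds
    refine tendsto_of_tendsto_of_tendsto_of_le_of_le' hl tendsto_const_nhds ?_ ?_
    · filter_upwards [hpos] with η hη
      exact one_sub_le_gaussTail (mul_nonneg (by positivity) hη.le)
    · filter_upwards [hpos] with η hη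
      exact (gaussTail_antitone (mul_nonneg (by positivity) hη.le)).trans_eq gaussTail_zero
  · filter_upwards [hpos] with η hη
    exact hasSum_thetaMean hη x

/-! ### Tails of weighted sums of logarithms of partial quotients -/

/-- The Gauss map `t ↦ {1/t}`. -/
noncomputable def gaussMap (t : ℝ) : ℝ := Int.fract t⁻¹

/-- The first partial quotient `⌊1/t⌋`. -/
noncomputable def cfDigit (t : ℝ) : ℕ := ⌊t⁻¹⌋₊

/-- `∑_{i < n} τ_i log a_{i+1}(t)`, where `a_1, a_2, …` are the partial quotients of `t`. -/
noncomputable def digitSum (τ : ℕ → ℝ) (n : ℕ) (t : ℝ) : ℝ :=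
  ∑ i ∈ Finset.range n, τ i * Real.log (cfDigit (gaussMap^[i] t))

theorem digitSum_succ (τ : ℕ → ℝ) (n : ℕ) (t : ℝ) : digitSum τ (n + 1) t =
    τ 0 * Real.log (cfDigit t) + digitSum (fun i => τ (i + 1)) n (gaussMap t) := by
  unfold digitSum
  rw [Finset.sum_range_succ', add_comm]
  simp [Function.iterate_succ_apply]

theorem measurable_gaussMap : Measurable gaussMap := measurable_fract.comp measurable_inv

theorem measurable_cfDigit : Measurable cfDigit := Nat.measurable_floor.comp measurable_inv

theorem measurable_digitSum (τ : ℕ → ℝ) (n : ℕ) : Measurable (digitSum τ n) := by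
  unfold digitSum
  refine Finset.measurable_sum _ fun i _ => Measurable.const_mul ?_ _
  exact (measurable_from_top (f := fun k : ℕ => Real.log k)).comp
    (measurable_cfDigit.comp (measurable_gaussMap.iterate i))

theorem digitSum_mono {τ : ℕ → ℝ} (hτ : ∀ i, 0 ≤ τ i) (t : ℝ) : Monotone fun n => digitSum τ n t := by
  intro m n h
  refine Finset.sum_le_sum_of_subset_of_nonneg (Finset.range_mono h) fun i _ _ => ?_
  exact mul_nonneg (hτ i) (Real.log_natCast_nonneg _)

/-- Integration over `(0,1)` against the density `1/(1+t)` of the Gauss measure. -/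
noncomputable def gaussLint (f : ℝ → ENNReal) : ENNReal :=
  ∫⁻ t in Set.Ioo (0 : ℝ) 1, ENNReal.ofReal (1 / (1 + t)) * f t

theorem gaussLint_mono {f g : ℝ → ENNReal} (h : ∀ t ∈ Set.Ioo (0 : ℝ) 1, f t ≤ g t) :
    gaussLint f ≤ gaussLint g :=
  setLIntegral_mono' measurableSet_Ioo fun t ht => by gcongr; exact h t ht

theorem gaussLint_mul_const {f : ℝ → ENNReal} (hf : Measurable f) (c : ENNReal) :
    gaussLint (fun t => f t * c) = gaussLint f * c := by
  unfold gaussLint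
  simp_rw [← mul_assoc]
  rw [lintegral_mul_const _ (by fun_prop)]

/-- The conditional probability of the first digit `k + 1`, given that `u` is the next iterate. -/
noncomputable def digitWeight (k : ℕ) (u : ℝ) : ℝ := (1 + u) / ((k + 1 + u) * (k + 2 + u))

theorem digitWeight_nonneg (k : ℕ) {u : ℝ} (hu : 0 < u) : 0 ≤ digitWeight k u := by
  unfold digitWeight; positivity

theorem digitWeight_le (k : ℕ) {u : ℝ} (hu : u ∈ Set.Ioo (0 : ℝ) 1) :
    digitWeight k u ≤ 2 * (1 / ((k : ℝ) + 1) ^ 2) := by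
  obtain ⟨h0, h1⟩ := hu
  unfold digitWeight
  have hk : (0 : ℝ) ≤ k := k.cast_nonneg
  rw [mul_one_div, pow_two]
  apply div_le_div₀ zero_le_two (by linarith) (by positivity)
  apply mul_le_mul <;> linarith

theorem measurable_digitWeight (k : ℕ) : Measurable (digitWeight k) := by
  unfold digitWeight; fun_prop

/-- Change of variables `t = 1/(k + 1 + u)` on each branch of the Gauss map: the Gauss density at
`t` times the Jacobian is `digitWeight k u` times the Gauss density at `u`. An inequality suffices,
so the branches only have to cover `(0,1)`. -/
theorem gaussLint_le_tsum (g : ℕ → ℝ → ENNReal) :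
    gaussLint (fun t => g (cfDigit t) (gaussMap t)) ≤
      ∑' k : ℕ, gaussLint (fun u => ENNReal.ofReal (digitWeight k u) * g (k + 1) u) := by
  set φ : ℕ → ℝ → ℝ := fun k u => ((k : ℝ) + 1 + u)⁻¹ with hφ
  have hcover : Set.Ioo (0 : ℝ) 1 ⊆ ⋃ k, φ k '' Set.Ico (0 : ℝ) 1 := by
    intro t ht
    have hinv : 1 < t⁻¹ := one_lt_inv_iff₀.2 ht
    have hfl : 1 ≤ ⌊t⁻¹⌋₊ := Nat.le_floor (by simpa using hinv.le)
    rw [Set.mem_iUnion]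
    refine ⟨⌊t⁻¹⌋₊ - 1, t⁻¹ - ⌊t⁻¹⌋₊, ⟨?_, ?_⟩, ?_⟩
    · linarith [Nat.floor_le (zero_le_one.trans hinv.le)]
    · linarith [Nat.lt_floor_add_one t⁻¹]
    · simp only [hφ]
      rw [Nat.cast_sub hfl]
      simp
  refine (lintegral_mono_set hcover).trans ((lintegral_iUnion_le _ _).trans
    (ENNReal.tsum_le_tsum fun k => ?_))
  have hpos : ∀ u ∈ Set.Ico (0 : ℝ) 1, 0 < (k : ℝ) + 1 + u := fun u hu => by
    have := hu.1
    positivity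
  rw [lintegral_image_eq_lintegral_abs_deriv_mul (f' := fun u => -1 / ((k : ℝ) + 1 + u) ^ 2)
    measurableSet_Ico]
  · unfold gaussLint
    rw [setLIntegral_congr (Ioo_ae_eq_Ico (a := (0 : ℝ)) (b := 1)).symm]
    refine setLIntegral_mono' measurableSet_Ioo fun u hu => ?_
    have hd : cfDigit (φ k u) = k + 1 := by
      simp only [hφ, cfDigit, inv_inv]
      rw [Nat.floor_eq_iff (hpos u ⟨hu.1.le, hu.2⟩).le]
      push_cast
      constructor <;> linarith [hu.1, hu.2]
    have hG : gaussMap (φ k u) = u := by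
      simp only [hφ, gaussMap, inv_inv]
      rw [Int.fract_eq_iff]
      exact ⟨hu.1.le, hu.2, k + 1, by push_cast; ring⟩
    simp only
    rw [hd, hG, ← mul_assoc, ← mul_assoc]
    refine mul_le_mul_left ?_ _
    have hp := hpos u ⟨hu.1.le, hu.2⟩
    have hu0 := hu.1
    rw [← ENNReal.ofReal_mul (abs_nonneg _), ← ENNReal.ofReal_mul (by positivity)]
    apply ENNReal.ofReal_le_ofReal
    rw [abs_div, abs_neg, abs_one, abs_of_pos (by positivity), digitWeight]
    simp only [hφ]
    apply le_of_eq
    field_simp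
    ring
  · intro u hu
    exact (((hasDerivAt_id' u).const_add ((k : ℝ) + 1)).fun_inv (hpos u hu).ne').hasDerivWithinAt
  · intro u hu v hv huv
    have := inv_injective huv
    linarith

theorem gaussLint_le {g : ℕ → ℝ → ENNReal} (hg : ∀ k, Measurable (g k)) :
    gaussLint (fun t => g (cfDigit t) (gaussMap t)) ≤
      gaussLint (fun u => ∑' k : ℕ, ENNReal.ofReal (digitWeight k u) * g (k + 1) u) := by
  refine (gaussLint_le_tsum g).trans_eq ?_
  unfold gaussLint
  rw [← lintegral_tsum]
  · simp_rw [ENNReal.tsum_mul_left]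
  · intro k
    have := measurable_digitWeight k
    have := hg (k + 1)
    fun_prop

/-- The weights telescope. For `m = 0` the bound is `1`, so they act as a probability; in general
the digit tail decays like `1/m`. -/
theorem tsum_digitWeight_le (m : ℕ) {u : ℝ} (hu : 0 < u) :
    ∑' k : ℕ, (if m ≤ k then ENNReal.ofReal (digitWeight k u) else 0) ≤
      ENNReal.ofReal ((1 + u) / (m + 1 + u)) := by
  refine ENNReal.tsum_le_of_sum_range_le fun N => ?_
  have hreal : ∑ k ∈ Finset.range N, (if m ≤ k then digitWeight k u else 0) ≤
      (1 + u) / (m + 1 + u) - (1 + u) / ((max m N : ℕ) + 1 + u) := by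
    induction N with
    | zero => simp
    | succ N ih =>
      rw [Finset.sum_range_succ]
      rcases le_or_gt m N with h | h
      · rw [if_pos h]
        rw [max_eq_right h] at ih
        rw [max_eq_right (by omega)]
        have : digitWeight N u = (1 + u) / (N + 1 + u) - (1 + u) / ((N + 1 : ℕ) + 1 + u) := by
          unfold digitWeight
          push_cast
          have h1 : (N : ℝ) + 1 + u ≠ 0 := by positivity
          have h2 : (N : ℝ) + 2 + u ≠ 0 := by positivity
          have h3 : (N : ℝ) + 1 + 1 + u ≠ 0 := by positivity
          field_simp
          ring
        linarith
      · rw [if_neg (by omega), add_zero, max_eq_left (by omega)]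
        rwa [max_eq_left h.le] at ih
  have hpos : 0 ≤ (1 + u) / ((max m N : ℕ) + 1 + u) := by positivity
  calc ∑ k ∈ Finset.range N, (if m ≤ k then ENNReal.ofReal (digitWeight k u) else 0)
      = ENNReal.ofReal (∑ k ∈ Finset.range N, (if m ≤ k then digitWeight k u else 0)) := by
        rw [ENNReal.ofReal_sum_of_nonneg]
        · refine Finset.sum_congr rfl fun k _ => ?_
          split_ifs <;> simp
        · intro k _
          split_ifs
          · exact digitWeight_nonneg k hu
          · rfl
    _ ≤ _ := ENNReal.ofReal_le_ofReal (by linarith)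

/-- `∑_{k ≥ 1} k^{-5/4}` -/
noncomputable def digitConst : ℝ := ∑' k : ℕ, ((k : ℝ) + 1) ^ (-(5 / 4) : ℝ)

theorem summable_digitConst : Summable fun k : ℕ => ((k : ℝ) + 1) ^ (-(5 / 4) : ℝ) := by
  have := (summable_nat_add_iff 1).2 (Real.summable_nat_rpow (p := -(5 / 4)).2 (by norm_num))
  simpa using this

theorem digitConst_pos : 0 < digitConst :=
  summable_digitConst.tsum_pos (fun k => by positivity) 0 (by simp)

theorem one_div_sq_mul_rpow (k : ℕ) :
    1 / ((k : ℝ) + 1) ^ 2 * ((k : ℝ) + 1) ^ (3 / 4 : ℝ) = ((k : ℝ) + 1) ^ (-(5 / 4) : ℝ) := by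
  have hk : (0 : ℝ) < (k : ℝ) + 1 := by positivity
  rw [one_div, ← Real.rpow_natCast, ← Real.rpow_neg hk.le, ← Real.rpow_add hk]
  norm_num

theorem exp_mul_log_le (k : ℕ) {τ : ℝ} (h : τ ≤ 3 / 4) :
    Real.exp (τ * Real.log ((k : ℝ) + 1)) ≤ ((k : ℝ) + 1) ^ (3 / 4 : ℝ) := by
  have hk : (1 : ℝ) ≤ (k : ℝ) + 1 := by linarith [k.cast_nonneg (α := ℝ)]
  rw [mul_comm, ← Real.rpow_def_of_pos (by positivity)]
  exact Real.rpow_le_rpow_of_exponent_le hk h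

/-- Bernoulli's inequality for the concave power `4τ/3 ≤ 1` of `(k+1)^(3/4)`. Linearity in `τ` is
the point: conditional moments become `1 + O(τ)`, and their product over all digits stays bounded.
-/
theorem exp_mul_log_le_one_add (k : ℕ) {τ : ℝ} (h0 : 0 ≤ τ) (h : τ ≤ 3 / 4) :
    Real.exp (τ * Real.log ((k : ℝ) + 1)) ≤ 1 + 4 / 3 * τ * ((k : ℝ) + 1) ^ (3 / 4 : ℝ) := by
  have hk : (1 : ℝ) ≤ (k : ℝ) + 1 := by linarith [k.cast_nonneg (α := ℝ)]
  have hp : (0 : ℝ) ≤ ((k : ℝ) + 1) ^ (3 / 4 : ℝ) := by positivity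
  have := rpow_one_add_le_one_add_mul_self (s := ((k : ℝ) + 1) ^ (3 / 4 : ℝ) - 1) (by linarith)
    (p := 4 / 3 * τ) (by positivity) (by linarith)
  rw [add_sub_cancel, ← Real.rpow_mul (by positivity), show 3 / 4 * (4 / 3 * τ) = τ by ring,
    Real.rpow_def_of_pos (by positivity), mul_comm] at this
  have h2 : 0 ≤ 4 / 3 * τ := by positivity
  nlinarith

theorem tsum_digitWeight_mul_exp_le {τ u : ℝ} (h0 : 0 ≤ τ) (h : τ ≤ 3 / 4)
    (hu : u ∈ Set.Ioo (0 : ℝ) 1) :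
    ∑' k : ℕ, ENNReal.ofReal (digitWeight k u) *
      ENNReal.ofReal (Real.exp (τ * Real.log ((k + 1 : ℕ) : ℝ))) ≤
      ENNReal.ofReal (Real.exp (8 / 3 * digitConst * τ)) := by
  have hle : ∀ k : ℕ, ENNReal.ofReal (digitWeight k u) *
      ENNReal.ofReal (Real.exp (τ * Real.log ((k + 1 : ℕ) : ℝ))) ≤
      (if 0 ≤ k then ENNReal.ofReal (digitWeight k u) else 0) +
        ENNReal.ofReal (8 / 3 * τ * ((k : ℝ) + 1) ^ (-(5 / 4) : ℝ)) := by
    intro k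
    have hw := digitWeight_nonneg k hu.1
    rw [if_pos (Nat.zero_le _), ← ENNReal.ofReal_mul hw, ← ENNReal.ofReal_add hw (by positivity)]
    apply ENNReal.ofReal_le_ofReal
    push_cast
    calc digitWeight k u * Real.exp (τ * Real.log ((k : ℝ) + 1))
        ≤ digitWeight k u * (1 + 4 / 3 * τ * ((k : ℝ) + 1) ^ (3 / 4 : ℝ)) := by
          gcongr; exact exp_mul_log_le_one_add k h0 h
      _ = digitWeight k u + digitWeight k u * (4 / 3 * τ * ((k : ℝ) + 1) ^ (3 / 4 : ℝ)) := by ring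
      _ ≤ digitWeight k u + 2 * (1 / ((k : ℝ) + 1) ^ 2) *
            (4 / 3 * τ * ((k : ℝ) + 1) ^ (3 / 4 : ℝ)) := by
          gcongr; exact digitWeight_le k hu
      _ = _ := by rw [← one_div_sq_mul_rpow]; ring
  refine (ENNReal.tsum_le_tsum hle).trans ?_
  rw [ENNReal.tsum_add]
  have h1 := tsum_digitWeight_le 0 hu.1
  have h2 : ∑' k : ℕ, ENNReal.ofReal (8 / 3 * τ * ((k : ℝ) + 1) ^ (-(5 / 4) : ℝ)) =
      ENNReal.ofReal (8 / 3 * digitConst * τ) := by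
    rw [← ENNReal.ofReal_tsum_of_nonneg (fun k => by positivity) (summable_digitConst.mul_left _),
      tsum_mul_left, ← digitConst]
    congr 1; ring
  rw [h2]
  refine (add_le_add_left h1 _).trans ?_
  have hu0 := hu.1
  have hK := digitConst_pos
  rw [← ENNReal.ofReal_add (by positivity) (by positivity)]
  apply ENNReal.ofReal_le_ofReal
  have : (1 + u) / (((0 : ℕ) : ℝ) + 1 + u) = 1 := by
    rw [Nat.cast_zero, zero_add, div_self (by positivity)]
  rw [this]
  linarith [Real.add_one_le_exp (8 / 3 * digitConst * τ)]

/-- Induction on the number of digits, conditioning on the next iterate `u`: the first digit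
contributes a factor uniform in `u`, and the remaining sum depends on `u` alone. -/
theorem gaussLint_exp_digitSum_le {τ : ℕ → ℝ} (h0 : ∀ i, 0 ≤ τ i) (h : ∀ i, τ i ≤ 3 / 4) (n : ℕ) :
    gaussLint (fun t => ENNReal.ofReal (Real.exp (digitSum τ n t))) ≤
      ENNReal.ofReal (Real.exp (8 / 3 * digitConst * ∑ i ∈ Finset.range n, τ i)) := by
  induction n generalizing τ with
  | zero =>
    simp only [digitSum, Finset.range_zero, Finset.sum_empty, Real.exp_zero, ENNReal.ofReal_one,
      mul_zero, gaussLint, mul_one]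
    calc ∫⁻ t in Set.Ioo (0 : ℝ) 1, ENNReal.ofReal (1 / (1 + t))
        ≤ ∫⁻ _ in Set.Ioo (0 : ℝ) 1, 1 := by
          refine setLIntegral_mono' measurableSet_Ioo fun t ht => ?_
          rw [← ENNReal.ofReal_one]
          apply ENNReal.ofReal_le_ofReal
          rw [div_le_one (by linarith [ht.1])]
          linarith [ht.1]
      _ = 1 := by simp
  | succ n ih =>
    set E := digitSum (fun i => τ (i + 1)) n with hE
    have hEm : Measurable E := measurable_digitSum _ n
    have hrw : ∀ t, ENNReal.ofReal (Real.exp (digitSum τ (n + 1) t)) =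
        (fun (k : ℕ) u => ENNReal.ofReal (Real.exp (τ 0 * Real.log k)) *
          ENNReal.ofReal (Real.exp (E u))) (cfDigit t) (gaussMap t) := by
      intro t
      simp only
      rw [digitSum_succ, Real.exp_add, ENNReal.ofReal_mul (Real.exp_pos _).le]
    simp_rw [hrw]
    refine (gaussLint_le (g := fun (k : ℕ) u => ENNReal.ofReal (Real.exp (τ 0 * Real.log k)) *
          ENNReal.ofReal (Real.exp (E u))) fun k => by fun_prop).trans ?_
    have hstep : ∀ u ∈ Set.Ioo (0 : ℝ) 1, ∑' k : ℕ, ENNReal.ofReal (digitWeight k u) *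
        (ENNReal.ofReal (Real.exp (τ 0 * Real.log ((k + 1 : ℕ) : ℝ))) *
          ENNReal.ofReal (Real.exp (E u))) ≤
        ENNReal.ofReal (Real.exp (E u)) * ENNReal.ofReal (Real.exp (8 / 3 * digitConst * τ 0)) := by
      intro u hu
      simp_rw [← mul_assoc]
      rw [ENNReal.tsum_mul_right, mul_comm]
      gcongr
      exact tsum_digitWeight_mul_exp_le (h0 0) (h 0) hu
    refine (gaussLint_mono hstep).trans ?_
    rw [gaussLint_mul_const (by fun_prop)]
    refine (mul_le_mul_left (ih (fun i => h0 (i + 1)) (fun i => h (i + 1))) _).trans_eq ?_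
    rw [← ENNReal.ofReal_mul (Real.exp_pos _).le, ← Real.exp_add, Finset.sum_range_succ']
    congr 2
    ring

/-- Conditionally on `u`, the first digit has to exceed `exp (L - E u)`, which has probability at
most `2 exp (E u - L)`; the exponential moment of the rest then closes the estimate. The first
weight may equal `1`, where its own exponential moment is not available. -/
theorem gaussLint_tail_of_strong {τ : ℕ → ℝ} (h1 : τ 0 ≤ 1) {n : ℕ} {B : ℝ} (hB : 0 ≤ B)
    (hstrong : gaussLint (fun t => ENNReal.ofReal (Real.exp (digitSum (fun i => τ (i + 1)) n t))) ≤
      ENNReal.ofReal B) (L : ℝ) :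
    gaussLint (fun t => if L < digitSum τ (n + 1) t then 1 else 0) ≤
      ENNReal.ofReal (2 * B * Real.exp (-L)) := by
  set E := digitSum (fun i => τ (i + 1)) n with hE
  have hEm : Measurable E := measurable_digitSum _ n
  simp_rw [digitSum_succ]
  refine (gaussLint_le (g := fun (k : ℕ) u => if L < τ 0 * Real.log k + E u then 1 else 0)
    fun k => Measurable.ite (measurableSet_lt measurable_const (by fun_prop)) measurable_const
      measurable_const).trans ?_
  have hstep : ∀ u ∈ Set.Ioo (0 : ℝ) 1, ∑' k : ℕ, ENNReal.ofReal (digitWeight k u) *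
      (if L < τ 0 * Real.log ((k + 1 : ℕ) : ℝ) + E u then 1 else 0) ≤
      ENNReal.ofReal (Real.exp (E u)) * ENNReal.ofReal (2 * Real.exp (-L)) := by
    intro u hu
    have hu0 := hu.1
    have hle : ∀ k : ℕ, ENNReal.ofReal (digitWeight k u) *
        (if L < τ 0 * Real.log ((k + 1 : ℕ) : ℝ) + E u then 1 else 0) ≤
        if ⌊Real.exp (L - E u)⌋₊ ≤ k then ENNReal.ofReal (digitWeight k u) else 0 := by
      intro k
      by_cases hL : L < τ 0 * Real.log ((k + 1 : ℕ) : ℝ) + E u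
      · rw [if_pos hL, if_pos, mul_one]
        have hlog := Real.log_natCast_nonneg (k + 1)
        have h2 : L - E u < Real.log ((k + 1 : ℕ) : ℝ) := by nlinarith
        rw [Real.lt_log_iff_exp_lt (by positivity)] at h2
        exact Nat.lt_succ_iff.1 ((Nat.floor_lt (Real.exp_pos _).le).2 h2)
      · rw [if_neg hL, mul_zero]; exact zero_le
    refine (ENNReal.tsum_le_tsum hle).trans ((tsum_digitWeight_le _ hu0).trans ?_)
    rw [← ENNReal.ofReal_mul (Real.exp_pos _).le]
    apply ENNReal.ofReal_le_ofReal
    have hfl := Nat.lt_floor_add_one (Real.exp (L - E u))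
    have hX := Real.exp_pos (L - E u)
    calc (1 + u) / ((⌊Real.exp (L - E u)⌋₊ : ℝ) + 1 + u) ≤ 2 / Real.exp (L - E u) := by
          gcongr <;> linarith [hu.2]
      _ = _ := by rw [Real.exp_sub, Real.exp_neg]; field_simp
  refine (gaussLint_mono hstep).trans ?_
  rw [gaussLint_mul_const (by fun_prop)]
  refine (mul_le_mul_left hstrong _).trans_eq ?_
  rw [← ENNReal.ofReal_mul hB]
  congr 1
  ring

/-- This puts a digit of small weight before a sum known only through its tail. Fixing the first
digit `a` lowers the threshold and costs a factor `a^τ ≤ a^(3/4)`, against a conditional probability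
at most `2/a²`; the sum over `a` converges. -/
theorem gaussLint_tail_of_weak {τ : ℕ → ℝ} (h1 : τ 0 ≤ 3 / 4) {n : ℕ} {B : ℝ} (hB : 0 ≤ B)
    (hweak : ∀ L, gaussLint (fun t => if L < digitSum (fun i => τ (i + 1)) n t then 1 else 0) ≤
      ENNReal.ofReal (B * Real.exp (-L))) (L : ℝ) :
    gaussLint (fun t => if L < digitSum τ (n + 1) t then 1 else 0) ≤
      ENNReal.ofReal (2 * digitConst * B * Real.exp (-L)) := by
  set E := digitSum (fun i => τ (i + 1)) n with hE
  have hEm : Measurable E := measurable_digitSum _ n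
  simp_rw [digitSum_succ]
  refine (gaussLint_le_tsum fun (k : ℕ) u => if L < τ 0 * Real.log k + E u then 1 else 0).trans ?_
  have hterm : ∀ k : ℕ, gaussLint (fun u => ENNReal.ofReal (digitWeight k u) *
      (if L < τ 0 * Real.log ((k + 1 : ℕ) : ℝ) + E u then 1 else 0)) ≤
      ENNReal.ofReal (2 * B * Real.exp (-L) * ((k : ℝ) + 1) ^ (-(5 / 4) : ℝ)) := by
    intro k
    have hle : ∀ u ∈ Set.Ioo (0 : ℝ) 1, ENNReal.ofReal (digitWeight k u) *
        (if L < τ 0 * Real.log ((k + 1 : ℕ) : ℝ) + E u then 1 else 0) ≤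
        (if L - τ 0 * Real.log ((k + 1 : ℕ) : ℝ) < E u then 1 else 0) *
          ENNReal.ofReal (2 * (1 / ((k : ℝ) + 1) ^ 2)) := by
      intro u hu
      rw [mul_comm]
      simp only [sub_lt_iff_lt_add']
      gcongr
      exact digitWeight_le k hu
    refine (gaussLint_mono hle).trans ?_
    rw [gaussLint_mul_const (Measurable.ite (measurableSet_lt measurable_const hEm)
      measurable_const measurable_const)]
    refine (mul_le_mul_left (hweak _) _).trans ?_
    rw [← ENNReal.ofReal_mul (by positivity)]
    apply ENNReal.ofReal_le_ofReal
    have he := exp_mul_log_le k h1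
    rw [neg_sub, sub_eq_add_neg, Real.exp_add, ← one_div_sq_mul_rpow]
    push_cast
    calc B * (Real.exp (τ 0 * Real.log ((k : ℝ) + 1)) * Real.exp (-L)) *
          (2 * (1 / ((k : ℝ) + 1) ^ 2))
        ≤ B * (((k : ℝ) + 1) ^ (3 / 4 : ℝ) * Real.exp (-L)) * (2 * (1 / ((k : ℝ) + 1) ^ 2)) := by
          gcongr
      _ = _ := by ring
  refine (ENNReal.tsum_le_tsum hterm).trans_eq ?_
  rw [← ENNReal.ofReal_tsum_of_nonneg (fun k => by positivity) (summable_digitConst.mul_left _),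
    tsum_mul_left, ← digitConst]
  congr 1
  ring

theorem volume_le_two_mul_gaussLint (p : ℝ → Prop) [DecidablePred p]
    (hp : MeasurableSet {t | p t}) :
    volume {t | t ∈ Set.Ioo (0 : ℝ) 1 ∧ p t} ≤ gaussLint (fun t => if p t then 1 else 0) * 2 := by
  have h1 : volume {t | t ∈ Set.Ioo (0 : ℝ) 1 ∧ p t} =
      ∫⁻ t in Set.Ioo (0 : ℝ) 1, if p t then 1 else 0 := by
    have : ∀ t, (if p t then (1 : ENNReal) else 0) = Set.indicator {t | p t} 1 t := by
      intro t; simp [Set.indicator_apply]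
    simp_rw [this]
    rw [lintegral_indicator_one hp, Measure.restrict_apply hp]
    congr 1
    ext t
    simp [and_comm]
  have hm : Measurable fun t => if p t then (1 : ENNReal) else 0 :=
    Measurable.ite hp measurable_const measurable_const
  rw [h1, ← gaussLint_mul_const hm]
  refine setLIntegral_mono' measurableSet_Ioo fun t ht => ?_
  have h2 : 1 ≤ ENNReal.ofReal (1 / (1 + t)) * 2 := by
    rw [← ENNReal.ofReal_ofNat 2, ← ENNReal.ofReal_mul (by have := ht.1; positivity),
      ← ENNReal.ofReal_one]
    apply ENNReal.ofReal_le_ofReal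
    rw [← mul_div_right_comm, le_div_iff₀ (by linarith [ht.1])]
    linarith [ht.2]
  simp only
  rw [mul_comm (ite _ _ _), ← mul_assoc]
  exact le_mul_of_one_le_left zero_le h2

/-- Weak-type bound for weighted sums of the logarithms of partial quotients: all weights but one of
the first two are below `3/4`, and that one is at most `1`. -/
theorem exists_volume_digitSum_le (S : ℝ) : ∃ C : ℝ, 0 < C ∧ ∀ τ : ℕ → ℝ, (∀ i, 0 ≤ τ i) →
    (∀ i, τ (i + 2) ≤ 3 / 4) → (τ 0 ≤ 1 ∧ τ 1 ≤ 3 / 4 ∨ τ 0 ≤ 3 / 4 ∧ τ 1 ≤ 1) →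
    (∀ n, ∑ i ∈ Finset.range n, τ i ≤ S) → ∀ (n : ℕ) (L : ℝ),
    volume {t | t ∈ Set.Ioo (0 : ℝ) 1 ∧ L < digitSum τ n t} ≤
      ENNReal.ofReal (C * Real.exp (-L)) := by
  have hK := digitConst_pos
  set B := Real.exp (8 / 3 * digitConst * S) with hBdef
  refine ⟨4 * B + 8 * digitConst * B, by positivity, fun τ h0 h2 h01 hS n L => ?_⟩
  -- Two extra digits are harmless because the terms are nonnegative, and they make both
  -- distinguished indices present for every `n`. The two constants come from the two positions of
  -- the large weight.
  have hg : gaussLint (fun t => if L < digitSum τ (n + 2) t then 1 else 0) ≤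
      ENNReal.ofReal ((2 * B + 4 * digitConst * B) * Real.exp (-L)) := by
    rcases h01 with ⟨ha, hb⟩ | ⟨ha, hb⟩
    · have hstr := gaussLint_exp_digitSum_le (τ := fun i => τ (i + 1)) (fun i => h0 _)
        (fun i => by rcases i with _ | i; exacts [hb, h2 i]) (n + 1)
      refine (gaussLint_tail_of_strong ha (B := B) (Real.exp_pos _).le (hstr.trans ?_) L).trans ?_
      · apply ENNReal.ofReal_le_ofReal
        rw [hBdef, Real.exp_le_exp]
        gcongr
        refine le_trans ?_ (hS (n + 2))
        rw [Finset.sum_range_succ' _ (n + 1)]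
        linarith [h0 0]
      · apply ENNReal.ofReal_le_ofReal
        gcongr
        have : 0 ≤ 4 * digitConst * B := by positivity
        linarith
    · have hstr := gaussLint_exp_digitSum_le (τ := fun i => τ (i + 2)) (fun i => h0 _) h2 n
      have hweak := gaussLint_tail_of_strong (τ := fun i => τ (i + 1)) (n := n) hb (B := B)
        (Real.exp_pos _).le (hstr.trans (by
          apply ENNReal.ofReal_le_ofReal
          rw [hBdef, Real.exp_le_exp]
          gcongr
          refine le_trans ?_ (hS (n + 2))
          rw [Finset.sum_range_succ' _ (n + 1), Finset.sum_range_succ' _ n]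
          linarith [h0 0, h0 1]))
      refine (gaussLint_tail_of_weak ha (B := 2 * B) (by positivity) hweak L).trans ?_
      apply ENNReal.ofReal_le_ofReal
      gcongr
      have : 0 ≤ 2 * B := by positivity
      linarith
  have hmeas : MeasurableSet {t | L < digitSum τ (n + 2) t} :=
    measurableSet_lt measurable_const (measurable_digitSum _ _)
  calc volume {t | t ∈ Set.Ioo (0 : ℝ) 1 ∧ L < digitSum τ n t}
      ≤ volume {t | t ∈ Set.Ioo (0 : ℝ) 1 ∧ L < digitSum τ (n + 2) t} := by
        refine measure_mono fun t ht => ⟨ht.1, ht.2.trans_le (digitSum_mono h0 t (by omega))⟩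
    _ ≤ _ := volume_le_two_mul_gaussLint _ hmeas
    _ ≤ ENNReal.ofReal ((2 * B + 4 * digitConst * B) * Real.exp (-L)) * 2 := by gcongr
    _ = _ := by
        rw [← ENNReal.ofReal_ofNat 2, ← ENNReal.ofReal_mul (by positivity)]
        congr 1
        ring

/-! ### Continued fraction intervals as Möbius images -/

theorem GenContFract.of_fract_s_get? (v : ℝ) (i : ℕ) :
    (GenContFract.of (Int.fract v)).s.get? i = (GenContFract.of v).s.get? i := by
  rcases i with _ | i
  · by_cases h : Int.fract v = 0
    · obtain ⟨z, hz⟩ := Int.fract_eq_zero_iff.1 h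
      have h1 : (GenContFract.of v).s = Stream'.Seq.nil := by
        rw [← hz]; exact GenContFract.of_s_of_int ℝ z
      have h2 : (GenContFract.of (Int.fract v)).s = Stream'.Seq.nil := by
        rw [h]; simpa using GenContFract.of_s_of_int ℝ 0
      rw [h1, h2]
    · have h1 := GenContFract.of_s_head h
      have h2 := GenContFract.of_s_head (v := Int.fract v) (by rwa [Int.fract_fract])
      rw [Int.fract_fract] at h2
      exact h2.trans h1.symm
  · rw [GenContFract.of_s_succ, GenContFract.of_s_succ, Int.fract_fract]

theorem GenContFract.partDens_get?_eq_some_iff (v : ℝ) (i : ℕ) (r : ℝ) :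
    (GenContFract.of v).partDens.get? i = some r ↔
      ∃ p, (GenContFract.of v).s.get? i = some p ∧ p.b = r := by
  rw [GenContFract.partDens, Stream'.Seq.map_get?, Option.map_eq_some_iff]

theorem mem_contFracInterval_cons_iff {k : ℕ} {l : List ℕ} {x : ℝ} :
    x ∈ contFracInterval (k :: l) ↔
      x ∈ Set.Ioo (0 : ℝ) 1 ∧ ⌊x⁻¹⌋ = k ∧ Int.fract x⁻¹ ∈ contFracInterval l := by
  constructor
  · rintro ⟨hx, h⟩
    have h0 := h 0 (by simp)
    rw [GenContFract.partDens_get?_eq_some_iff] at h0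
    obtain ⟨p, hp, hpb⟩ := h0
    have hfr : Int.fract x = x := Int.fract_eq_self.2 hx
    have hx0 : x ≠ 0 := by
      rintro rfl
      have : (GenContFract.of (0 : ℝ)).s = Stream'.Seq.nil := by
        simpa using GenContFract.of_s_of_int ℝ 0
      rw [this] at hp
      simp at hp
    have hhead := GenContFract.of_s_head (v := x) (by rwa [hfr])
    rw [hfr] at hhead
    have hpe : p = ⟨1, ⌊x⁻¹⌋⟩ := Option.some_injective _ (hp.symm.trans hhead)
    refine ⟨⟨lt_of_le_of_ne hx.1 hx0.symm, hx.2⟩, ?_, ⟨Int.fract_nonneg _, Int.fract_lt_one _⟩, ?_⟩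
    · rw [hpe] at hpb
      simp only [List.getElem_cons_zero] at hpb
      exact_mod_cast hpb
    · intro i hi
      have hi' := h (i + 1) (by simpa using hi)
      rw [GenContFract.partDens_get?_eq_some_iff] at hi' ⊢
      rw [GenContFract.of_s_succ, hfr] at hi'
      rw [GenContFract.of_fract_s_get?]
      simpa using hi'
  · rintro ⟨hx, hk, hl⟩
    have hfr : Int.fract x = x := Int.fract_eq_self.2 ⟨hx.1.le, hx.2⟩
    refine ⟨⟨hx.1.le, hx.2⟩, fun i hi => ?_⟩
    rw [GenContFract.partDens_get?_eq_some_iff]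
    rcases i with _ | i
    · have hhead := GenContFract.of_s_head (v := x) (by rw [hfr]; exact hx.1.ne')
      rw [hfr] at hhead
      exact ⟨_, hhead, by simp [hk]⟩
    · have := hl.2 i (by simpa using hi)
      rw [GenContFract.partDens_get?_eq_some_iff, GenContFract.of_fract_s_get?] at this
      rw [GenContFract.of_s_succ, hfr]
      simpa using this

/-- The interval of a finite continued fraction is, up to an endpoint, the image of `(0,1)` under
the Möbius map of its last two convergents `p/q` and `p'/q'`. -/
theorem exists_moebius_contFracInterval (a : List ℕ) (ha : ∀ k ∈ a, 0 < k) :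
    ∃ p q p' q' : ℕ, 0 < q ∧ q' ≤ q ∧ p' + q' ≤ p + q ∧ |(p : ℤ) * q' - p' * q| = 1 ∧
      finContFrac a = (p : ℚ) / q ∧
      (∀ t ∈ Set.Ioo (0 : ℝ) 1, (p + p' * t) / (q + q' * t) ∈ contFracInterval a) ∧
      ∀ x ∈ contFracInterval a, ∃ t ∈ Set.Ico (0 : ℝ) 1, x = (p + p' * t) / (q + q' * t) := by
  induction a with
  | nil =>
    refine ⟨0, 1, 1, 0, one_pos, zero_le_one, le_rfl, by norm_num, by simp [finContFrac], ?_, ?_⟩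
    · intro t ht
      refine ⟨?_, fun i hi => absurd hi (by simp)⟩
      simpa using ⟨ht.1.le, ht.2⟩
    · intro x hx
      exact ⟨x, hx.1, by simp⟩
  | cons k l ih =>
    obtain ⟨p, q, p', q', hq, hqq, hpq, hdet, hfc, hin, hout⟩ :=
      ih fun j hj => ha j (List.mem_cons_of_mem k hj)
    have hk : 1 ≤ k := ha k List.mem_cons_self
    have hkR : (1 : ℝ) ≤ k := by exact_mod_cast hk
    have hqR : (0 : ℝ) < q := by exact_mod_cast hq
    have hden : ∀ t : ℝ, 0 ≤ t → (0 : ℝ) < q + q' * t := fun t ht => by positivity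
    have hden2 : ∀ t : ℝ, 0 ≤ t → (0 : ℝ) < ((k * q + p : ℕ) : ℝ) + (k * q' + p' : ℕ) * t := by
      intro t ht
      have : 0 < k * q + p := by positivity
      have : (0 : ℝ) < (k * q + p : ℕ) := by exact_mod_cast this
      positivity
    have hinv : ∀ t : ℝ, 0 ≤ t → (((q : ℕ) + q' * t) /
        (((k * q + p : ℕ) : ℝ) + (k * q' + p' : ℕ) * t))⁻¹ = k + (p + p' * t) / (q + q' * t) := by
      intro t ht
      have h1 := (hden t ht).ne'
      rw [inv_div]
      push_cast
      field_simp
      ring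
    -- These are the coefficients of `1/(k + M(t))` for the old map `M`. The invariant `p' + q' ≤ p
    -- + q` is what preserves `q' ≤ q`, even when `k = 1`.
    refine ⟨q, k * q + p, q', k * q' + p', by positivity, ?_, ?_, ?_, ?_, ?_, ?_⟩
    · obtain ⟨j, rfl⟩ := Nat.exists_eq_add_of_le hk
      have : j * q' ≤ j * q := Nat.mul_le_mul_left _ hqq
      nlinarith
    · have : k * q' ≤ k * q := Nat.mul_le_mul_left _ hqq
      omega
    · rw [← hdet, abs_sub_comm]
      congr 1
      push_cast
      ring
    · have hqQ : (q : ℚ) ≠ 0 := by exact_mod_cast hq.ne'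
      rw [finContFrac, hfc]
      push_cast
      field_simp
    · intro t ht
      have h2 := hden2 t ht.1.le
      have hmem := hin t ht
      have hlt : ((q : ℕ) + q' * t) / (((k * q + p : ℕ) : ℝ) + (k * q' + p' : ℕ) * t) < 1 := by
        have hx1 : 1 < (((q : ℕ) + q' * t) /
          (((k * q + p : ℕ) : ℝ) + (k * q' + p' : ℕ) * t))⁻¹ := by
          rw [hinv t ht.1.le]
          have hpp : p + p' ≠ 0 := by
            intro h0
            have e1 : p = 0 := by omega
            have e2 : p' = 0 := by omega
            rw [e1, e2] at hdet
            norm_num at hdet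
          have hnum : (0 : ℝ) < p + p' * t := by
            have ht0 := ht.1
            rcases Nat.eq_zero_or_pos p with h | h
            · have : (0 : ℝ) < p' := by exact_mod_cast (show 0 < p' by omega)
              positivity
            · have : (0 : ℝ) < p := by exact_mod_cast h
              positivity
          have := div_pos hnum (hden t ht.1.le)
          linarith
        exact (one_lt_inv_iff₀.1 hx1).2
      rw [mem_contFracInterval_cons_iff, hinv t ht.1.le]
      have hfl : ⌊(k : ℝ) + (p + p' * t) / (q + q' * t)⌋ = k := by
        rw [Int.floor_eq_iff]
        push_cast
        constructor <;> linarith [hmem.1.1, hmem.1.2]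
      refine ⟨⟨div_pos (hden t ht.1.le) h2, hlt⟩, hfl, ?_⟩
      rw [Int.fract, hfl]
      push_cast
      rwa [add_sub_cancel_left]
    · intro x hx
      rw [mem_contFracInterval_cons_iff] at hx
      obtain ⟨hx01, hfl, hfr⟩ := hx
      obtain ⟨t, ht, hxt⟩ := hout _ hfr
      refine ⟨t, ht, ?_⟩
      rw [← inv_inj, hinv t ht.1, ← hxt, Int.fract, hfl]
      push_cast
      ring

/-- The determinant is `±1`, so the Jacobian is `(q + q't)^(-2)`; with `q' ≤ q` it lies between
`1/(4q²)` and `1/q²`, the bounded distortion used below. -/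
theorem volume_moebius_image {q q' p p' : ℕ} (hq : 0 < q) (hdet : |(p : ℤ) * q' - p' * q| = 1)
    {s : Set ℝ} (hs : MeasurableSet s) (hs01 : s ⊆ Set.Ico 0 1) :
    volume ((fun t : ℝ => (p + p' * t) / (q + q' * t)) '' s) =
      ∫⁻ t in s, ENNReal.ofReal (1 / (q + q' * t) ^ 2) := by
  have hden : ∀ t ∈ s, (0 : ℝ) < q + q' * t := fun t ht => by
    have h0 := (hs01 ht).1
    have : (0 : ℝ) < q := by exact_mod_cast hq
    positivity
  have hdetR : |(p' : ℝ) * q - p * q'| = 1 := by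
    rw [abs_sub_comm]; exact_mod_cast hdet
  have hdet0 : (p' : ℝ) * q - p * q' ≠ 0 := by
    intro h; rw [h] at hdetR; norm_num at hdetR
  have hderiv : ∀ t ∈ s, HasDerivWithinAt (fun t : ℝ => (p + p' * t) / (q + q' * t))
      ((p' * q - p * q') / (q + q' * t) ^ 2) s t := by
    intro t ht
    have h := ((((hasDerivAt_id' t).const_mul (p' : ℝ)).const_add (p : ℝ)).fun_div
      (((hasDerivAt_id' t).const_mul (q' : ℝ)).const_add (q : ℝ)) (hden t ht).ne').hasDerivWithinAt
      (s := s)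
    refine h.congr_deriv ?_
    congr 1
    ring
  have hinj : Set.InjOn (fun t : ℝ => (p + p' * t) / (q + q' * t)) s := by
    intro t ht u hu h
    simp only at h
    rw [div_eq_div_iff (hden t ht).ne' (hden u hu).ne'] at h
    have : ((p' : ℝ) * q - p * q') * (t - u) = 0 := by linear_combination h
    rcases mul_eq_zero.1 this with h | h
    · exact absurd h hdet0
    · linarith
  have := lintegral_image_eq_lintegral_abs_deriv_mul hs hderiv hinj 1
  simp only [Pi.one_apply, lintegral_const, Measure.restrict_apply_univ, one_mul, mul_one] at this
  rw [this]
  refine setLIntegral_congr_fun hs fun t ht => ?_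
  rw [abs_div, hdetR, abs_of_nonneg (by positivity)]

theorem volume_moebius_image_le {q q' p p' : ℕ} (hq : 0 < q)
    (hdet : |(p : ℤ) * q' - p' * q| = 1) {s : Set ℝ} (hs : MeasurableSet s)
    (hs01 : s ⊆ Set.Ico 0 1) :
    volume ((fun t : ℝ => (p + p' * t) / (q + q' * t)) '' s) ≤
      ENNReal.ofReal (1 / (q : ℝ) ^ 2) * volume s := by
  rw [volume_moebius_image hq hdet hs hs01, ← setLIntegral_const]
  refine setLIntegral_mono' hs fun t ht => ENNReal.ofReal_le_ofReal ?_
  have : (0 : ℝ) < q := by exact_mod_cast hq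
  have h0 := (hs01 ht).1
  have : (0 : ℝ) ≤ q' * t := by positivity
  gcongr
  linarith

theorem le_volume_moebius_image {q q' p p' : ℕ} (hq : 0 < q) (hqq : q' ≤ q)
    (hdet : |(p : ℤ) * q' - p' * q| = 1) :
    ENNReal.ofReal (1 / (4 * (q : ℝ) ^ 2)) ≤
      volume ((fun t : ℝ => (p + p' * t) / (q + q' * t)) '' Set.Ioo 0 1) := by
  rw [volume_moebius_image hq hdet measurableSet_Ioo Set.Ioo_subset_Ico_self]
  have : ENNReal.ofReal (1 / (4 * (q : ℝ) ^ 2)) =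
      ∫⁻ _ in Set.Ioo (0 : ℝ) 1, ENNReal.ofReal (1 / (4 * (q : ℝ) ^ 2)) := by
    simp
  rw [this]
  refine setLIntegral_mono' measurableSet_Ioo fun t ht => ENNReal.ofReal_le_ofReal ?_
  have hqR : (0 : ℝ) < q := by exact_mod_cast hq
  have h0 := ht.1
  have hq' : (q' : ℝ) ≤ q := by exact_mod_cast hqq
  have h1 : (q : ℝ) + q' * t ≤ 2 * q := by nlinarith [ht.2, q'.cast_nonneg (α := ℝ)]
  rw [show 4 * (q : ℝ) ^ 2 = (2 * q) ^ 2 by ring]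
  gcongr

/-! ### Denominators of the later convergents -/

theorem gaussMap_mem_Ioo {t : ℝ} (ht : Irrational t) :
    gaussMap t ∈ Set.Ioo (0 : ℝ) 1 := by
  refine ⟨lt_of_le_of_ne (Int.fract_nonneg _) ?_, Int.fract_lt_one _⟩
  intro h
  obtain ⟨z, hz⟩ := Int.fract_eq_zero_iff.1 h.symm
  exact ht.inv ⟨z, by push_cast; exact hz⟩

theorem irrational_gaussMap {t : ℝ} (ht : Irrational t) : Irrational (gaussMap t) :=
  ht.inv.sub_intCast _

theorem iterate_gaussMap {t : ℝ} (ht : Irrational t) (h01 : t ∈ Set.Ioo (0 : ℝ) 1) (n : ℕ) :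
    Irrational (gaussMap^[n] t) ∧ gaussMap^[n] t ∈ Set.Ioo (0 : ℝ) 1 := by
  induction n with
  | zero => exact ⟨ht, h01⟩
  | succ n ih =>
    rw [Function.iterate_succ_apply']
    exact ⟨irrational_gaussMap ih.1, gaussMap_mem_Ioo ih.1⟩

theorem one_le_cfDigit {t : ℝ} (h01 : t ∈ Set.Ioo (0 : ℝ) 1) : 1 ≤ cfDigit t :=
  Nat.le_floor (by simpa using (one_lt_inv_iff₀.2 h01).le)

theorem cfDigit_add_gaussMap {t : ℝ} (h01 : t ∈ Set.Ioo (0 : ℝ) 1) :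
    t = ((cfDigit t : ℝ) + gaussMap t)⁻¹ := by
  have h0 : (0 : ℝ) ≤ t⁻¹ := inv_nonneg.2 h01.1.le
  rw [eq_comm, inv_eq_iff_eq_inv, gaussMap, cfDigit, Int.fract]
  have : ((⌊t⁻¹⌋₊ : ℕ) : ℝ) = ((⌊t⁻¹⌋ : ℤ) : ℝ) := by
    rw [← Int.natCast_floor_eq_floor h0]; simp
  rw [this]
  ring

/-- The denominators of the convergents that follow two given ones. -/
noncomputable def convDen (q q' : ℕ) (t : ℝ) : ℕ → ℕ
  | 0 => q'
  | 1 => q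
  | n + 2 => cfDigit (gaussMap^[n] t) * convDen q q' t (n + 1) + convDen q q' t n

/-- Each convergent of `x` beyond `p/q` gives the same configuration as `p/q` itself: `x` is the
Möbius image, with determinant `±1`, of an iterate of `t`. Estimates proved at one level therefore
apply at all levels. -/
theorem exists_convergent {p q p' q' : ℕ} (hq : 0 < q) (hqq : q' ≤ q)
    (hdet : |(p : ℤ) * q' - p' * q| = 1) {t : ℝ} (ht : Irrational t)
    (h01 : t ∈ Set.Ioo (0 : ℝ) 1) (n : ℕ) :
    0 < convDen q q' t (n + 1) ∧ convDen q q' t n ≤ convDen q q' t (n + 1) ∧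
    ∃ a b : ℕ, |(a : ℤ) * convDen q q' t n - b * convDen q q' t (n + 1)| = 1 ∧
      (p + p' * t) / (q + q' * t) = (a + b * gaussMap^[n] t) /
        (convDen q q' t (n + 1) + convDen q q' t n * gaussMap^[n] t) := by
  induction n with
  | zero => exact ⟨hq, hqq, p, p', hdet, rfl⟩
  | succ n ih =>
    obtain ⟨hpos, hle, a, b, hd, hx⟩ := ih
    obtain ⟨hirr, hmem⟩ := iterate_gaussMap ht h01 n
    obtain ⟨hirr', hmem'⟩ := iterate_gaussMap ht h01 (n + 1)
    set u := gaussMap^[n] t with hu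
    have hk := one_le_cfDigit hmem
    have e : convDen q q' t (n + 1 + 1) =
      cfDigit u * convDen q q' t (n + 1) + convDen q q' t n := rfl
    have hle' : convDen q q' t (n + 1) ≤ convDen q q' t (n + 1 + 1) := by
      rw [e]; nlinarith
    refine ⟨hpos.trans_le hle', hle', cfDigit u * a + b, a, ?_, ?_⟩
    · rw [← hd, abs_sub_comm, e]
      congr 1
      push_cast
      ring
    · rw [hx, e, Function.iterate_succ_apply', ← hu]
      rw [Function.iterate_succ_apply', ← hu] at hmem'
      have hu' := cfDigit_add_gaussMap hmem
      set v := gaussMap u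
      set k := cfDigit u
      have hv0 := hmem'.1
      have hkv : (0 : ℝ) < (k : ℝ) + v := by positivity
      have hposR : (0 : ℝ) < convDen q q' t (n + 1) := by exact_mod_cast hpos
      rw [hu']
      have h1 : (0 : ℝ) < convDen q q' t (n + 1) + convDen q q' t n * ((k : ℝ) + v)⁻¹ := by
        positivity
      have h2 : (0 : ℝ) < ((k * convDen q q' t (n + 1) + convDen q q' t n : ℕ) : ℝ) +
          convDen q q' t (n + 1) * v := by
        push_cast
        have : (0 : ℝ) ≤ k * convDen q q' t (n + 1) + convDen q q' t n := by positivity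
        have : 0 < convDen q q' t (n + 1) * v := by positivity
        linarith
      rw [div_eq_div_iff h1.ne' h2.ne']
      push_cast
      field_simp
      ring

theorem two_pow_mul_le_convDen {q q' : ℕ} {p p' : ℕ} (hq : 0 < q) (hqq : q' ≤ q)
    (hdet : |(p : ℤ) * q' - p' * q| = 1) {t : ℝ} (ht : Irrational t)
    (h01 : t ∈ Set.Ioo (0 : ℝ) 1) (n : ℕ) : 2 ^ (n / 2) * q ≤ convDen q q' t (n + 1) := by
  have hstep : ∀ n, 2 * convDen q q' t (n + 1) ≤ convDen q q' t (n + 3) := by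
    intro n
    have h1 := (exists_convergent hq hqq hdet ht h01 (n + 1)).2.1
    have hk := one_le_cfDigit (iterate_gaussMap ht h01 (n + 1)).2
    have e : convDen q q' t (n + 3) = cfDigit (gaussMap^[n + 1] t) * convDen q q' t (n + 2) +
      convDen q q' t (n + 1) := rfl
    rw [e]
    nlinarith
  induction n using Nat.twoStepInduction with
  | zero => simp [convDen]
  | one => simpa [convDen] using (exists_convergent hq hqq hdet ht h01 1).2.1
  | more n ih _ =>
    have : (n + 2) / 2 = n / 2 + 1 := by omega
    rw [this, pow_succ]
    linarith [hstep n]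

/-- Two even denominators would make the determinant `±1` even. -/
theorem odd_convDen_or {q q' p p' : ℕ} (hq : 0 < q) (hqq : q' ≤ q)
    (hdet : |(p : ℤ) * q' - p' * q| = 1) {t : ℝ} (ht : Irrational t)
    (h01 : t ∈ Set.Ioo (0 : ℝ) 1) (n : ℕ) :
    Odd (convDen q q' t n) ∨ Odd (convDen q q' t (n + 1)) := by
  obtain ⟨-, -, a, b, hd, -⟩ := exists_convergent hq hqq hdet ht h01 n
  by_contra hcon
  rw [not_or, Nat.not_odd_iff_even, Nat.not_odd_iff_even] at hcon
  obtain ⟨⟨c, hc⟩, ⟨d, hdd⟩⟩ := hcon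
  have : (2 : ℤ) ∣ (a : ℤ) * convDen q q' t n - b * convDen q q' t (n + 1) := by
    rw [hc, hdd]
    exact ⟨a * c - b * d, by push_cast; ring⟩
  rw [← dvd_abs, hd] at this
  norm_num at this

/-! ### The theta integral between consecutive scales -/

theorem im_two_mul_add_mul_I (x y : ℝ) : (2 * ((x : ℂ) + (y : ℝ) * Complex.I)).im = 2 * y := by
  simp

theorem differentiableAt_jacobiTheta_two_mul {z : ℂ} (hz : 0 < z.im) :
    DifferentiableAt ℂ (fun z => jacobiTheta (2 * z)) z := by
  have h2 : 0 < (2 * z).im := by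
    rw [show (2 : ℂ) = ((2 : ℝ) : ℂ) by norm_num, Complex.im_ofReal_mul]
    positivity
  exact (differentiableAt_jacobiTheta h2).comp z (by fun_prop)

theorem continuousOn_thetaMean_integrand (x : ℝ) :
    ContinuousOn (fun v : ℝ => (√2 : ℂ) *
      (jacobiTheta (2 * (x + (v ^ 2 : ℝ) * Complex.I)) - 1)) (Set.Ioi 0) := by
  have h : ContinuousOn (fun v : ℝ => jacobiTheta (2 * (x + (v ^ 2 : ℝ) * Complex.I)))
      (Set.Ioi 0) := by
    intro v hv
    have hv0 : (0 : ℝ) < v := hv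
    have hc : ContinuousAt (fun z => jacobiTheta (2 * z)) (x + (v ^ 2 : ℝ) * Complex.I) :=
      (differentiableAt_jacobiTheta_two_mul (by simp [-Complex.ofReal_pow]; positivity)).continuousAt
    have hf : ContinuousAt (fun v : ℝ => (x : ℂ) + (v ^ 2 : ℝ) * Complex.I) v := by fun_prop
    exact (ContinuousAt.comp (f := fun v : ℝ => (x : ℂ) + (v ^ 2 : ℝ) * Complex.I) hc
      hf).continuousWithinAt
  fun_prop

theorem integrableOn_thetaMean_integrand (x : ℝ) {η : ℝ} (hη : 0 < η) :
    IntegrableOn (fun v : ℝ => (√2 : ℂ) *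
      (jacobiTheta (2 * (x + (v ^ 2 : ℝ) * Complex.I)) - 1)) (Set.Ioi η) := by
  have hg : Integrable fun v : ℝ => √2 * (2 / (1 - Real.exp (-Real.pi * (2 * η ^ 2))) *
      Real.exp (-(2 * Real.pi) * v ^ 2)) :=
    ((integrable_exp_neg_mul_sq (by positivity)).const_mul _).const_mul _
  refine Integrable.mono' hg.integrableOn
    ((continuousOn_thetaMean_integrand x).mono (Set.Ioi_subset_Ioi hη.le)
      |>.aestronglyMeasurable measurableSet_Ioi) ?_
  refine (ae_restrict_iff' measurableSet_Ioi).2 (Eventually.of_forall fun v hv => ?_)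
  have hv' : η < v := hv
  have hv0 : 0 < v := hη.trans hv'
  have him := im_two_mul_add_mul_I x (v ^ 2)
  have hb := norm_jacobiTheta_sub_one_le (τ := 2 * ((x : ℂ) + (v ^ 2 : ℝ) * Complex.I))
    (by rw [him]; positivity)
  rw [him] at hb
  rw [norm_mul, Complex.norm_real, Real.norm_of_nonneg (by positivity)]
  refine mul_le_mul_of_nonneg_left (hb.trans ?_) (by positivity)
  rw [show -Real.pi * (2 * v ^ 2) = -(2 * Real.pi) * v ^ 2 by ring]
  have h1 : Real.exp (-Real.pi * (2 * η ^ 2)) < 1 := by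
    rw [Real.exp_lt_one_iff]
    have : 0 < Real.pi * (2 * η ^ 2) := by positivity
    linarith
  have h2 : Real.exp (-(2 * Real.pi) * v ^ 2) ≤ Real.exp (-Real.pi * (2 * η ^ 2)) := by
    rw [Real.exp_le_exp]
    have : η ^ 2 ≤ v ^ 2 := by gcongr
    have := mul_le_mul_of_nonneg_left this Real.pi_pos.le
    linarith
  have h3 : 0 < 1 - Real.exp (-Real.pi * (2 * η ^ 2)) := by linarith
  gcongr

/-- Bound for the integrand of `thetaMean` near a rational number. -/
noncomputable def nearMajorant (q : ℕ) (d v : ℝ) : ℝ :=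
  √2 + gaussWeight q * ((√d + v) / (d + v ^ 2)) +
    √2 * thetaConst * q * (d * v ^ (-(3 / 2) : ℝ) + v ^ (1 / 2 : ℝ))

theorem norm_integrand_le_nearMajorant {p : ℤ} {q : ℕ} (hq : 0 < q) (hpq : IsCoprime p q) {x v : ℝ}
    (hv : 0 < v) (hx : 0 < |x - p / q|) :
    ‖(√2 : ℂ) * (jacobiTheta (2 * (x + (v ^ 2 : ℝ) * Complex.I)) - 1)‖ ≤
      nearMajorant q |x - p / q| v := by
  set w : ℂ := ((x - p / q : ℝ) : ℂ) + (v ^ 2 : ℝ) * Complex.I with hw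
  set d := |x - p / q| with hd
  have hwim : w.im = v ^ 2 := by simp [hw, -Complex.ofReal_pow, -Complex.ofReal_sub]
  have hwre : w.re = x - p / q := by simp [hw, -Complex.ofReal_pow, -Complex.ofReal_sub]
  have hxw : (x : ℂ) + (v ^ 2 : ℝ) * Complex.I = p / q + w := by
    rw [hw]; push_cast; ring
  have hb := norm_jacobiTheta_two_mul_rat_add_le hq hpq (w := w) (by rw [hwim]; positivity)
  have hlow1 : d ≤ ‖w‖ := by rw [hd, ← hwre]; exact Complex.abs_re_le_norm w
  have hlow2 : v ^ 2 ≤ ‖w‖ := by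
    have := Complex.abs_im_le_norm w
    rwa [hwim, abs_of_nonneg (by positivity)] at this
  have hup : ‖w‖ ≤ d + v ^ 2 := by
    have := Complex.norm_le_abs_re_add_abs_im w
    rwa [hwre, hwim, abs_of_nonneg (sq_nonneg v)] at this
  have hw0 : 0 < ‖w‖ := hx.trans_le hlow1
  have hs0 : 0 < √‖w‖ := Real.sqrt_pos.2 hw0
  have hr : √d ≤ √‖w‖ := Real.sqrt_le_sqrt hlow1
  have hv' : v ≤ √‖w‖ := Real.le_sqrt_of_sq_le hlow2
  have hsq : √d ^ 2 = d := Real.sq_sqrt hx.le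
  have hsd := Real.sqrt_nonneg d
  -- Both `√d` and `v` are at most `√‖w‖`, so `d + v² ≤ √‖w‖ (√d + v)`. This majorant keeps the
  -- right size and has an elementary primitive.
  have hmain : 1 / √‖w‖ ≤ (√d + v) / (d + v ^ 2) := by
    rw [div_le_div_iff₀ hs0 (by positivity), one_mul]
    nlinarith
  rw [hxw, norm_mul, Complex.norm_real, Real.norm_of_nonneg (by positivity)]
  have h1 : ‖jacobiTheta (2 * (p / q + w)) - 1‖ ≤ gaussWeight q / √(2 * ‖w‖) +
      thetaConst * (q * ‖w‖ * w.im ^ (-(3 / 4) : ℝ)) + 1 :=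
    (norm_sub_le _ _).trans (by rw [norm_one]; gcongr)
  refine (mul_le_mul_of_nonneg_left h1 (Real.sqrt_nonneg 2)).trans ?_
  have hG := gaussWeight_nonneg q
  have hK := thetaConst_nonneg
  have e1 : √2 * (gaussWeight q / √(2 * ‖w‖)) = gaussWeight q * (1 / √‖w‖) := by
    rw [Real.sqrt_mul zero_le_two]; field_simp
  have e2 : w.im ^ (-(3 / 4) : ℝ) = v ^ (-(3 / 2) : ℝ) := by
    rw [hwim, ← Real.rpow_natCast, ← Real.rpow_mul hv.le]; norm_num
  have e3 : v ^ 2 * v ^ (-(3 / 2) : ℝ) = v ^ (1 / 2 : ℝ) := by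
    rw [← Real.rpow_natCast, ← Real.rpow_add hv]; norm_num
  have h2 : ‖w‖ * v ^ (-(3 / 2) : ℝ) ≤ d * v ^ (-(3 / 2) : ℝ) + v ^ (1 / 2 : ℝ) := by
    rw [← e3, ← add_mul]; gcongr
  unfold nearMajorant
  rw [mul_add, mul_add, e1, e2]
  calc gaussWeight q * (1 / √‖w‖) + √2 * (thetaConst * (q * ‖w‖ * v ^ (-(3 / 2) : ℝ))) + √2 * 1
      = √2 + gaussWeight q * (1 / √‖w‖) +
        √2 * thetaConst * q * (‖w‖ * v ^ (-(3 / 2) : ℝ)) := by ring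
    _ ≤ _ := by gcongr

noncomputable def nearPrimitive (q : ℕ) (d v : ℝ) : ℝ :=
  √2 * v + gaussWeight q * (1 / 2 * Real.log (d + v ^ 2) + Real.arctan (v / √d)) +
    √2 * thetaConst * q * (-2 * d * v ^ (-(1 / 2) : ℝ) + 2 / 3 * v ^ (3 / 2 : ℝ))

theorem hasDerivAt_nearPrimitive (q : ℕ) {d v : ℝ} (hd : 0 < d) (hv : 0 < v) :
    HasDerivAt (nearPrimitive q d) (nearMajorant q d v) v := by
  have h1 := (hasDerivAt_id' v).const_mul (√2)
  have h2 := ((((hasDerivAt_pow 2 v).const_add d).log (by positivity)).const_mul (1 / 2 : ℝ)).add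
    ((hasDerivAt_id' v).div_const (√d)).arctan
  have h3 := ((Real.hasDerivAt_rpow_const (x := v) (p := -(1 / 2)) (Or.inl hv.ne')).const_mul
    (-2 * d)).add ((Real.hasDerivAt_rpow_const (x := v) (p := 3 / 2) (Or.inl hv.ne')).const_mul
    (2 / 3 : ℝ))
  have h := (h1.add (h2.const_mul (gaussWeight q))).add (h3.const_mul (√2 * thetaConst * q))
  refine h.congr_deriv ?_
  unfold nearMajorant
  have hs : 0 < √d := Real.sqrt_pos.2 hd
  have hsq : √d ^ 2 = d := Real.sq_sqrt hd.le
  have e1 : 1 / 2 * ((2 : ℕ) * v ^ (2 - 1) / (d + v ^ 2)) + 1 / (1 + (v / √d) ^ 2) * (1 / √d) =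
      (√d + v) / (d + v ^ 2) := by
    rw [← hsq]
    field_simp
    norm_num
    ring
  rw [e1, show (-(1 / 2) - 1 : ℝ) = -(3 / 2) by norm_num,
    show (3 / 2 - 1 : ℝ) = 1 / 2 by norm_num]
  ring

theorem nearMajorant_nonneg (q : ℕ) {d v : ℝ} (hd : 0 ≤ d) (hv : 0 < v) :
    0 ≤ nearMajorant q d v := by
  have hG := gaussWeight_nonneg q
  have hK := thetaConst_nonneg
  unfold nearMajorant
  positivity

theorem integral_nearMajorant (q : ℕ) {d a b : ℝ} (hd : 0 < d) (ha : 0 < a) (hab : a ≤ b) :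
    IntegrableOn (nearMajorant q d) (Set.Ioc a b) ∧
      ∫ v in Set.Ioc a b, nearMajorant q d v = nearPrimitive q d b - nearPrimitive q d a := by
  have hderiv : ∀ v ∈ Set.uIcc a b, HasDerivAt (nearPrimitive q d) (nearMajorant q d v) v := by
    intro v hv
    rw [Set.uIcc_of_le hab] at hv
    exact hasDerivAt_nearPrimitive q hd (ha.trans_le hv.1)
  have hint : IntervalIntegrable (nearMajorant q d) volume a b := by
    apply ContinuousOn.intervalIntegrable
    rw [Set.uIcc_of_le hab]
    intro v hv
    have hv0 : 0 < v := ha.trans_le hv.1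
    have h1 : d + v ^ 2 ≠ 0 := by positivity
    have h2 := (Real.continuousAt_rpow_const v (-(3 / 2)) (Or.inl hv0.ne'))
    have h3 := (Real.continuousAt_rpow_const v (1 / 2) (Or.inl hv0.ne'))
    apply ContinuousAt.continuousWithinAt
    unfold nearMajorant
    fun_prop (disch := assumption)
  refine ⟨(intervalIntegrable_iff_integrableOn_Ioc_of_le hab).1 hint, ?_⟩
  rw [← intervalIntegral.integral_of_le hab, intervalIntegral.integral_eq_sub_of_hasDerivAt hderiv hint]

noncomputable def levelConst : ℝ := 8 + 8 * thetaConst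

/-- The main term is `½ log (d + v²)`, which grows by about `½ log k` because `d` is comparable to
`1/(kq²)`. The arctangent is bounded, and the linear and error terms are `O(q^(-1/2))`. -/
theorem nearPrimitive_sub_le {q k : ℕ} (hq : 0 < q) (hk : 1 ≤ k) {d : ℝ}
    (hd1 : 1 / (2 * ((k : ℝ) + 1) * q ^ 2) ≤ d) (hd2 : d ≤ 1 / (k * q ^ 2)) :
    nearPrimitive q d (1 / q) - nearPrimitive q d (1 / ((k + 1) * q)) ≤
      gaussWeight q / 2 * Real.log k + levelConst / √q := by
  have hqR : (0 : ℝ) < q := by exact_mod_cast hq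
  have hq1 : (1 : ℝ) ≤ q := by exact_mod_cast hq
  have hkR : (1 : ℝ) ≤ k := by exact_mod_cast hk
  have hd0 : 0 < d := lt_of_lt_of_le (by positivity) hd1
  have hG := gaussWeight_nonneg q
  have hK := thetaConst_nonneg
  set s := √(q : ℝ) with hs
  have hs0 : 0 < s := Real.sqrt_pos.2 hqR
  have hss : s ^ 2 = q := Real.sq_sqrt hqR.le
  have hs1 : 1 ≤ s := Real.one_le_sqrt.2 hq1
  have h2 : √2 ≤ 3 / 2 := by rw [Real.sqrt_le_left (by norm_num)]; norm_num
  have hGs : gaussWeight q ≤ 3 / 2 / s := (gaussWeight_le q).trans (by rw [← hs]; gcongr)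
  -- the logarithmic part
  have hlog : 1 / 2 * Real.log (d + (1 / q) ^ 2) - 1 / 2 * Real.log (d + (1 / ((k + 1) * q)) ^ 2) ≤
      1 / 2 * Real.log k + 3 / 2 := by
    -- From `d ≤ 1/q² ≤ 4kd`, so the left side is at most `2/q² ≤ 8kd`.
    have hle : d + (1 / q) ^ 2 ≤ 8 * k * (d + (1 / ((k + 1) * q)) ^ 2) := by
      have e1 : d ≤ (1 / q) ^ 2 := by
        refine hd2.trans ?_
        rw [one_div_pow]
        gcongr
        nlinarith [sq_nonneg (q : ℝ)]
      have e2 : (1 / (q : ℝ)) ^ 2 ≤ 4 * k * d := by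
        calc (1 / (q : ℝ)) ^ 2 = 2 * (k + 1) * (1 / (2 * ((k : ℝ) + 1) * q ^ 2)) := by field_simp
          _ ≤ 2 * (k + 1) * d := by gcongr
          _ ≤ 4 * k * d := by nlinarith
      have e3 : (0 : ℝ) ≤ 8 * k * (1 / ((k + 1) * q)) ^ 2 := by positivity
      linarith
    have h := Real.log_le_log (by positivity) hle
    rw [Real.log_mul (by positivity) (by positivity), Real.log_mul (by norm_num) (by positivity)] at h
    have h8 : Real.log 8 ≤ 3 := by
      rw [show (8 : ℝ) = 2 ^ 3 by norm_num, Real.log_pow]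
      have := Real.log_two_lt_d9
      push_cast
      linarith
    linarith
  have hat1 : Real.arctan (1 / q / √d) ≤ 2 := by
    linarith [Real.arctan_lt_pi_div_two (1 / q / √d), Real.pi_lt_four]
  have hat2 : 0 ≤ Real.arctan (1 / ((k + 1) * q) / √d) :=
    Real.arctan_nonneg.2 (by positivity)
  have hA : gaussWeight q * (1 / 2 * Real.log (d + (1 / q) ^ 2) + Real.arctan (1 / q / √d)) -
      gaussWeight q * (1 / 2 * Real.log (d + (1 / ((k + 1) * q)) ^ 2) +
        Real.arctan (1 / ((k + 1) * q) / √d)) ≤ gaussWeight q / 2 * Real.log k + 6 / s := by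
    calc _ = gaussWeight q * (1 / 2 * Real.log (d + (1 / q) ^ 2) -
          1 / 2 * Real.log (d + (1 / ((k + 1) * q)) ^ 2) + (Real.arctan (1 / q / √d) -
          Real.arctan (1 / ((k + 1) * q) / √d))) := by ring
      _ ≤ gaussWeight q * (1 / 2 * Real.log k + 3 / 2 + 2) := by gcongr; linarith
      _ = gaussWeight q / 2 * Real.log k + gaussWeight q * (7 / 2) := by ring
      _ ≤ gaussWeight q / 2 * Real.log k + 3 / 2 / s * (7 / 2) := by gcongr
      _ ≤ _ := by
        gcongr
        rw [div_mul_eq_mul_div]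
        gcongr
        norm_num
  -- the linear part
  have hB : √2 * (1 / q) - √2 * (1 / ((k + 1) * q)) ≤ 3 / 2 / s := by
    have e : 1 / (q : ℝ) ≤ 1 / s := by gcongr; nlinarith
    have e' : (0 : ℝ) ≤ √2 * (1 / ((k + 1) * q)) := by positivity
    have : √2 * (1 / (q : ℝ)) ≤ 3 / 2 * (1 / s) := by gcongr
    rw [div_eq_mul_one_div (3 / 2) s]
    linarith
  -- the error part
  have hr1 : (1 / ((k + 1) * (q : ℝ))) ^ (-(1 / 2) : ℝ) = √((k : ℝ) + 1) * s := by
    rw [one_div, Real.inv_rpow (by positivity), Real.rpow_neg (by positivity), inv_inv,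
      ← Real.sqrt_eq_rpow, Real.sqrt_mul (by positivity)]
  have hr2 : (1 / (q : ℝ)) ^ (3 / 2 : ℝ) = 1 / (q * s) := by
    rw [Real.div_rpow zero_le_one hqR.le, Real.one_rpow, show (3 / 2 : ℝ) = 1 + 1 / 2 by norm_num,
      Real.rpow_add hqR, Real.rpow_one, ← Real.sqrt_eq_rpow]
  have hk2 : √((k : ℝ) + 1) ≤ 3 / 2 * k := by
    rw [Real.sqrt_le_left (by positivity)]
    nlinarith
  have hC : √2 * thetaConst * q * (-2 * d * (1 / (q : ℝ)) ^ (-(1 / 2) : ℝ) +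
        2 / 3 * (1 / (q : ℝ)) ^ (3 / 2 : ℝ)) -
      √2 * thetaConst * q * (-2 * d * (1 / ((k + 1) * (q : ℝ))) ^ (-(1 / 2) : ℝ) +
        2 / 3 * (1 / ((k + 1) * (q : ℝ))) ^ (3 / 2 : ℝ)) ≤ 8 * thetaConst / s := by
    have n1 : (0 : ℝ) ≤ 2 * d * (1 / (q : ℝ)) ^ (-(1 / 2) : ℝ) := by positivity
    have n2 : (0 : ℝ) ≤ 2 / 3 * (1 / ((k + 1) * (q : ℝ))) ^ (3 / 2 : ℝ) := by positivity
    rw [← mul_sub]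
    have hqd : q * d ≤ 1 / (k * q) := by
      calc q * d ≤ q * (1 / (k * q ^ 2)) := by gcongr
        _ = 1 / (k * q) := by field_simp
    have e1 : q * (2 * d * (√((k : ℝ) + 1) * s)) ≤ 3 / s := by
      calc q * (2 * d * (√((k : ℝ) + 1) * s)) = 2 * (q * d) * (√((k : ℝ) + 1) * s) := by ring
        _ ≤ 2 * (1 / (k * q)) * (3 / 2 * k * s) := by gcongr
        _ = 3 / s := by rw [← hss]; field_simp
    have e2 : q * (2 / 3 * (1 / (q * s))) = 2 / 3 / s := by field_simp
    calc √2 * thetaConst * q * (-2 * d * (1 / (q : ℝ)) ^ (-(1 / 2) : ℝ) +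
          2 / 3 * (1 / (q : ℝ)) ^ (3 / 2 : ℝ) -
          (-2 * d * (1 / ((k + 1) * (q : ℝ))) ^ (-(1 / 2) : ℝ) +
          2 / 3 * (1 / ((k + 1) * (q : ℝ))) ^ (3 / 2 : ℝ)))
        ≤ √2 * thetaConst * q * (2 * d * (1 / ((k + 1) * (q : ℝ))) ^ (-(1 / 2) : ℝ) +
          2 / 3 * (1 / (q : ℝ)) ^ (3 / 2 : ℝ)) := by
          gcongr; linarith
      _ = √2 * thetaConst * (q * (2 * d * (√((k : ℝ) + 1) * s)) + q * (2 / 3 * (1 / (q * s)))) := by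
          rw [hr1, hr2]; ring
      _ ≤ √2 * thetaConst * (3 / s + 2 / 3 / s) := by rw [e2]; gcongr
      _ = √2 * (11 / 3) * (thetaConst / s) := by ring
      _ ≤ 8 * (thetaConst / s) := by gcongr; linarith
      _ = _ := by ring
  unfold nearPrimitive levelConst
  have : (8 + 8 * thetaConst) / s = 6 / s + 3 / 2 / s + 8 * thetaConst / s + 1 / 2 / s := by ring
  rw [this]
  have : 0 ≤ 1 / 2 / s := by positivity
  linarith

theorem norm_thetaMean_sub_le {η η' : ℝ} (hη : 0 < η) (h : η ≤ η') (x : ℝ) :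
    ‖thetaMean η x - thetaMean η' x‖ ≤ ∫ v in Set.Ioc η η',
      ‖(√2 : ℂ) * (jacobiTheta (2 * (x + (v ^ 2 : ℝ) * Complex.I)) - 1)‖ := by
  have hi := integrableOn_thetaMean_integrand x hη
  unfold thetaMean
  rw [← Set.Ioc_union_Ioi_eq_Ioi h, setIntegral_union Set.Ioc_disjoint_Ioi_same measurableSet_Ioi
    (hi.mono_set Set.Ioc_subset_Ioi_self) (hi.mono_set (Set.Ioi_subset_Ioi h)), add_sub_cancel_right]
  exact norm_integral_le_integral_norm _

/-- The contribution to the series at `x` of one convergent `p/q` of `x`. -/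
theorem norm_thetaMean_level_le {p q p' q' : ℕ} (hq : 0 < q) (hqq : q' ≤ q)
    (hdet : |(p : ℤ) * q' - p' * q| = 1) {t : ℝ} (h01 : t ∈ Set.Ioo (0 : ℝ) 1)  :
    ‖thetaMean (1 / (cfDigit t * q + q' : ℕ)) ((p + p' * t) / (q + q' * t)) -
      thetaMean (1 / q) ((p + p' * t) / (q + q' * t))‖ ≤
      gaussWeight q / 2 * Real.log (cfDigit t) + levelConst / √q := by
  set x := (p + p' * t) / (q + q' * t) with hx
  set k := cfDigit t with hk
  have hk1 : 1 ≤ k := one_le_cfDigit h01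
  have hkR : (1 : ℝ) ≤ k := by exact_mod_cast hk1
  have hqR : (0 : ℝ) < q := by exact_mod_cast hq
  have hqq' : (q' : ℝ) ≤ q := by exact_mod_cast hqq
  have hq'0 : (0 : ℝ) ≤ q' := q'.cast_nonneg
  have ht0 := h01.1
  have hden : (0 : ℝ) < q + q' * t := by positivity
  have hdetR : |(p' : ℝ) * q - p * q'| = 1 := by
    rw [abs_sub_comm]; exact_mod_cast hdet
  have hcop : IsCoprime (p : ℤ) (q : ℤ) := by
    rcases (abs_eq zero_le_one).1 hdet with h | h
    · exact ⟨q', -p', by linarith⟩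
    · exact ⟨-q', p', by linarith⟩
  have hdx : |x - ((p : ℤ) : ℝ) / q| = t / (q * (q + q' * t)) := by
    have : x - ((p : ℤ) : ℝ) / q = (p' * q - p * q') * (t / (q * (q + q' * t))) := by
      rw [hx]; push_cast; field_simp; ring
    rw [this, abs_mul, hdetR, one_mul, abs_of_nonneg (by positivity)]
  have hinv0 : (0 : ℝ) ≤ t⁻¹ := inv_nonneg.2 ht0.le
  have hkt1 : (k : ℝ) ≤ t⁻¹ := Nat.floor_le hinv0
  have hkt2 : t⁻¹ < (k : ℝ) + 1 := Nat.lt_floor_add_one _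
  have ht1 : t ≤ 1 / k := by rw [one_div]; exact (le_inv_comm₀ (by positivity) ht0).1 hkt1
  have ht2 : 1 / ((k : ℝ) + 1) ≤ t := by
    rw [one_div]; exact (inv_le_comm₀ ht0 (by positivity)).1 hkt2.le
  have hd1 : 1 / (2 * ((k : ℝ) + 1) * q ^ 2) ≤ |x - ((p : ℤ) : ℝ) / q| := by
    rw [hdx]
    calc 1 / (2 * ((k : ℝ) + 1) * q ^ 2) = 1 / ((k : ℝ) + 1) / (q * (2 * q)) := by field_simp
      _ ≤ t / (q * (q + q' * t)) := by
        gcongr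
        nlinarith [h01.2]
  have hd2 : |x - ((p : ℤ) : ℝ) / q| ≤ 1 / (k * q ^ 2) := by
    rw [hdx]
    calc t / (q * (q + q' * t)) ≤ 1 / k / (q * q) := by
          gcongr
          have : 0 ≤ q' * t := by positivity
          linarith
      _ = 1 / (k * q ^ 2) := by field_simp
  have hd0 : 0 < |x - ((p : ℤ) : ℝ) / q| := lt_of_lt_of_le (by positivity) hd1
  have hQ : (0 : ℝ) < (k * q + q' : ℕ) := by push_cast; positivity
  have hη0 : (0 : ℝ) < 1 / (k * q + q' : ℕ) := by positivity
  have hη1 : (1 : ℝ) / (k * q + q' : ℕ) ≤ 1 / q := by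
    gcongr
    exact (Nat.le_mul_of_pos_left _ hk1).trans (Nat.le_add_right _ _)
  -- The range of integration is enlarged to a lower limit free of `q'`; the majorant is
  -- nonnegative.
  have hη2 : 1 / (((k : ℝ) + 1) * q) ≤ 1 / (k * q + q' : ℕ) := by
    gcongr
    push_cast
    linarith
  have hlow : 0 < 1 / (((k : ℝ) + 1) * q) := by positivity
  obtain ⟨hint, hval⟩ := integral_nearMajorant q hd0 hlow (hη2.trans hη1)
  refine (norm_thetaMean_sub_le hη0 hη1 x).trans ?_
  calc ∫ v in Set.Ioc (1 / ((k * q + q' : ℕ) : ℝ)) (1 / q),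
        ‖(√2 : ℂ) * (jacobiTheta (2 * (x + (v ^ 2 : ℝ) * Complex.I)) - 1)‖
      ≤ ∫ v in Set.Ioc (1 / ((k * q + q' : ℕ) : ℝ)) (1 / q),
        nearMajorant q |x - ((p : ℤ) : ℝ) / q| v := by
        refine setIntegral_mono_on ((integrableOn_thetaMean_integrand x hη0).mono_set
          Set.Ioc_subset_Ioi_self).norm (hint.mono_set (Set.Ioc_subset_Ioc_left hη2))
          measurableSet_Ioc fun v hv => ?_
        exact norm_integrand_le_nearMajorant hq hcop (hη0.trans hv.1) hd0
    _ ≤ ∫ v in Set.Ioc (1 / (((k : ℝ) + 1) * q)) (1 / q),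
        nearMajorant q |x - ((p : ℤ) : ℝ) / q| v := by
        refine setIntegral_mono_set hint ?_
          (Eventually.of_forall (Set.Ioc_subset_Ioc_left hη2))
        refine (ae_restrict_iff' measurableSet_Ioc).2 (Eventually.of_forall fun v hv => ?_)
        exact nearMajorant_nonneg q hd0.le (hlow.trans hv.1)
    _ ≤ _ := by
        rw [hval]
        exact nearPrimitive_sub_le hq hk1 hd1 hd2

/-! ### Scales coarser than the denominator -/

theorem norm_jacobiTheta_le_of_mem_cone {p : ℤ} {q : ℕ} (hq : 0 < q) (hpq : IsCoprime p q) {w : ℂ}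
    {y : ℝ} (hy : 0 < y) (h1 : y / 2 ≤ w.im) (h2 : ‖w‖ ≤ 3 * y) :
    ‖jacobiTheta (2 * (p / q + w))‖ ≤
      2 / √q * y ^ (-(1 / 2) : ℝ) + 6 * thetaConst * q * y ^ (1 / 4 : ℝ) := by
  have hqR : (0 : ℝ) < q := by exact_mod_cast hq
  have hK := thetaConst_nonneg
  have him : 0 < w.im := lt_of_lt_of_le (by positivity) h1
  have hw : y / 2 ≤ ‖w‖ := h1.trans ((le_abs_self _).trans (Complex.abs_im_le_norm w))
  refine (norm_jacobiTheta_two_mul_rat_add_le hq hpq him).trans ?_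
  have e1 : gaussWeight q / √(2 * ‖w‖) ≤ 2 / √q * y ^ (-(1 / 2) : ℝ) := by
    have h2' : √2 ≤ 2 := by rw [Real.sqrt_le_left (by norm_num)]; norm_num
    rw [Real.rpow_neg hy.le, ← Real.sqrt_eq_rpow, ← div_eq_mul_inv]
    have : gaussWeight q ≤ 2 / √q := (gaussWeight_le q).trans (by gcongr)
    gcongr
    linarith
  have e2 : w.im ^ (-(3 / 4) : ℝ) ≤ 2 * y ^ (-(3 / 4) : ℝ) := by
    calc w.im ^ (-(3 / 4) : ℝ) ≤ (y / 2) ^ (-(3 / 4) : ℝ) :=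
          Real.rpow_le_rpow_of_nonpos (by positivity) h1 (by norm_num)
      _ = y ^ (-(3 / 4) : ℝ) * 2 ^ (3 / 4 : ℝ) := by
          rw [Real.div_rpow hy.le zero_le_two, Real.rpow_neg zero_le_two (3 / 4), div_inv_eq_mul]
      _ ≤ y ^ (-(3 / 4) : ℝ) * 2 ^ (1 : ℝ) := by
          gcongr <;> norm_num
      _ = _ := by rw [Real.rpow_one]; ring
  have e3 : y * y ^ (-(3 / 4) : ℝ) = y ^ (1 / 4 : ℝ) := by
    rw [← Real.rpow_one_add' hy.le (by norm_num)]; norm_num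
  have e4 : thetaConst * (q * ‖w‖ * w.im ^ (-(3 / 4) : ℝ)) ≤
      6 * thetaConst * q * y ^ (1 / 4 : ℝ) := by
    calc thetaConst * (q * ‖w‖ * w.im ^ (-(3 / 4) : ℝ))
        ≤ thetaConst * (q * (3 * y) * (2 * y ^ (-(3 / 4) : ℝ))) := by gcongr
      _ = _ := by rw [← e3]; ring
  linarith

/-- Cauchy's estimate on discs of radius `y/2`, which stay in a cone above `p/q`, bounds the
derivative; the mean value inequality is then applied at height `y`. -/
theorem norm_jacobiTheta_sub_center_le {p : ℤ} {q : ℕ} (hq : 0 < q) (hpq : IsCoprime p q)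
    {x y : ℝ} (hx : |x - p / q| ≤ y) (hy : 0 < y) :
    ‖jacobiTheta (2 * (x + y * Complex.I)) - jacobiTheta (2 * (((p / q : ℝ) : ℂ) + y * Complex.I))‖ ≤
      2 / y * (2 / √q * y ^ (-(1 / 2) : ℝ) + 6 * thetaConst * q * y ^ (1 / 4 : ℝ)) *
        |x - p / q| := by
  set M := 2 / √q * y ^ (-(1 / 2) : ℝ) + 6 * thetaConst * q * y ^ (1 / 4 : ℝ)
  set s : Set ℂ := {z | z.im = y ∧ |z.re - p / q| ≤ y} with hs
  have hconv : Convex ℝ s := by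
    have h1 : Convex ℝ (Complex.im ⁻¹' {y}) := (convex_singleton y).linear_preimage Complex.imLm
    have h2 : Convex ℝ (Complex.re ⁻¹' Metric.closedBall (p / q : ℝ) y) :=
      (convex_closedBall (p / q : ℝ) y).linear_preimage Complex.reLm
    have he : s = Complex.im ⁻¹' {y} ∩ Complex.re ⁻¹' Metric.closedBall (p / q : ℝ) y := by
      ext z
      simp [hs, Real.dist_eq]
    rw [he]
    exact h1.inter h2
  have hdiff : ∀ z ∈ s, DifferentiableAt ℂ (fun z => jacobiTheta (2 * z)) z := fun z hz =>
    differentiableAt_jacobiTheta_two_mul (by rw [hz.1]; exact hy)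
  have hderiv : ∀ z ∈ s, ‖deriv (fun z => jacobiTheta (2 * z)) z‖ ≤ 2 / y * M := by
    intro z hz
    have hball : ∀ u ∈ Metric.closedBall z (y / 2), y / 2 ≤ u.im := by
      intro u hu
      rw [Metric.mem_closedBall, dist_eq_norm] at hu
      have := (Complex.abs_im_le_norm (u - z)).trans hu
      rw [Complex.sub_im, hz.1, abs_le] at this
      linarith
    have hcl : closure (Metric.ball z (y / 2)) = Metric.closedBall z (y / 2) :=
      closure_ball z (by positivity)
    have hdc : DiffContOnCl ℂ (fun z => jacobiTheta (2 * z)) (Metric.ball z (y / 2)) := by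
      apply DifferentiableOn.diffContOnCl
      rw [hcl]
      intro u hu
      exact (differentiableAt_jacobiTheta_two_mul
        (lt_of_lt_of_le (by positivity) (hball u hu))).differentiableWithinAt
    have h := Complex.norm_deriv_le_of_forall_mem_sphere_norm_le (C := M) (half_pos hy) hdc ?_
    · refine h.trans_eq ?_
      field_simp
    · intro u hu
      have hu' := Metric.sphere_subset_closedBall hu
      set w : ℂ := u - ((p / q : ℝ) : ℂ) with hw
      have hu_eq : u = p / q + w := by rw [hw]; push_cast; ring
      have him : w.im = u.im := by rw [hw, Complex.sub_im, Complex.ofReal_im, sub_zero]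
      rw [hu_eq]
      refine norm_jacobiTheta_le_of_mem_cone hq hpq hy (by rw [him]; exact hball u hu') ?_
      have h1 : ‖u - z‖ ≤ y / 2 := by rwa [Metric.mem_closedBall, dist_eq_norm] at hu'
      have h2 : ‖z - ((p / q : ℝ) : ℂ)‖ ≤ y + y := by
        refine (Complex.norm_le_abs_re_add_abs_im _).trans ?_
        rw [Complex.sub_re, Complex.sub_im, Complex.ofReal_re, Complex.ofReal_im, sub_zero, hz.1,
          abs_of_pos hy]
        exact add_le_add hz.2 le_rfl
      calc ‖w‖ = ‖(u - z) + (z - ((p / q : ℝ) : ℂ))‖ := by rw [hw]; congr 1; ring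
        _ ≤ y / 2 + (y + y) := (norm_add_le _ _).trans (add_le_add h1 h2)
        _ ≤ 3 * y := by linarith
  have hmem1 : (((p / q : ℝ) : ℂ) + y * Complex.I) ∈ s := by
    refine ⟨by simp [-Complex.ofReal_div], ?_⟩
    simpa [-Complex.ofReal_div] using hy.le
  have hmem2 : ((x : ℂ) + y * Complex.I) ∈ s := ⟨by simp, by simpa using hx⟩
  have := hconv.norm_image_sub_le_of_norm_deriv_le hdiff hderiv hmem1 hmem2
  refine this.trans_eq ?_
  congr 1
  rw [add_sub_add_right_eq_sub, ← Complex.ofReal_sub, Complex.norm_real, Real.norm_eq_abs]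

noncomputable def centerConst : ℝ := 2 * (2 + 24 * thetaConst)

/-- The part of the series at scales coarser than `1/q` is almost constant near `p/q`. -/
theorem norm_thetaMean_sub_center_le {p : ℤ} {q : ℕ} (hq : 0 < q) (hpq : IsCoprime p q) {x : ℝ}
    (hx : |x - p / q| ≤ 1 / (q : ℝ) ^ 2) :
    ‖thetaMean (1 / q) x - thetaMean (1 / q) (p / q)‖ ≤ centerConst / √q := by
  have hqR : (0 : ℝ) < q := by exact_mod_cast hq
  have hK := thetaConst_nonneg
  have hη : (0 : ℝ) < 1 / q := by positivity
  have i1 := integrableOn_thetaMean_integrand x hη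
  have i2 := integrableOn_thetaMean_integrand (p / q) hη
  have h2 : √2 ≤ 2 := by rw [Real.sqrt_le_left (by norm_num)]; norm_num
  have g3 : IntegrableOn (fun v : ℝ => v ^ (-3 : ℝ)) (Set.Ioi (1 / (q : ℝ))) :=
    integrableOn_Ioi_rpow_of_lt (by norm_num) hη
  have g32 : IntegrableOn (fun v : ℝ => v ^ (-(3 / 2) : ℝ)) (Set.Ioi (1 / (q : ℝ))) :=
    integrableOn_Ioi_rpow_of_lt (by norm_num) hη
  unfold thetaMean
  rw [← integral_sub i1 i2]
  refine (norm_integral_le_integral_norm _).trans ?_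
  have hpt : ∀ v ∈ Set.Ioi (1 / (q : ℝ)),
      ‖(√2 : ℂ) * (jacobiTheta (2 * (x + (v ^ 2 : ℝ) * Complex.I)) - 1) -
        (√2 : ℂ) * (jacobiTheta (2 * (((p / q : ℝ) : ℂ) + (v ^ 2 : ℝ) * Complex.I)) - 1)‖ ≤
      4 / q ^ 2 * (2 / √q) * v ^ (-3 : ℝ) + 4 / q ^ 2 * (6 * thetaConst * q) * v ^ (-(3 / 2) : ℝ) := by
    intro v hv
    have hv' : 1 / (q : ℝ) < v := hv
    have hv0 : 0 < v := hη.trans hv'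
    -- Since `v > 1/q`, the horizontal distance to `p/q` is at most the height `v²`, as the cone
    -- estimate requires.
    have hxv : |x - p / q| ≤ v ^ 2 := hx.trans (by rw [← one_div_pow]; gcongr)
    have hc := norm_jacobiTheta_sub_center_le hq hpq hxv (by positivity)
    rw [← mul_sub, sub_sub_sub_cancel_right, norm_mul, Complex.norm_real,
      Real.norm_of_nonneg (Real.sqrt_nonneg 2)]
    have r1 : (v ^ 2) ^ (-(1 / 2) : ℝ) = v ^ (-1 : ℝ) := by
      rw [← Real.rpow_natCast, ← Real.rpow_mul hv0.le]; norm_num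
    have r2 : (v ^ 2) ^ (1 / 4 : ℝ) = v ^ (1 / 2 : ℝ) := by
      rw [← Real.rpow_natCast, ← Real.rpow_mul hv0.le]; norm_num
    have r3 : 1 / v ^ 2 = v ^ (-2 : ℝ) := by
      rw [Real.rpow_neg hv0.le, one_div]; norm_num
    have r4 : v ^ (-2 : ℝ) * v ^ (-1 : ℝ) = v ^ (-3 : ℝ) := by
      rw [← Real.rpow_add hv0]; norm_num
    have r5 : v ^ (-2 : ℝ) * v ^ (1 / 2 : ℝ) = v ^ (-(3 / 2) : ℝ) := by
      rw [← Real.rpow_add hv0]; norm_num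
    calc √2 * _ ≤ 2 * (2 / v ^ 2 * (2 / √q * (v ^ 2) ^ (-(1 / 2) : ℝ) +
          6 * thetaConst * q * (v ^ 2) ^ (1 / 4 : ℝ)) * (1 / q ^ 2)) := by
          refine mul_le_mul h2 (hc.trans ?_) (norm_nonneg _) zero_le_two
          gcongr
      _ = 4 / q ^ 2 * (2 / √q) * ((1 / v ^ 2) * v ^ (-1 : ℝ)) +
          4 / q ^ 2 * (6 * thetaConst * q) * ((1 / v ^ 2) * v ^ (1 / 2 : ℝ)) := by
          rw [r1, r2]; ring
      _ = _ := by rw [r3, r4, r5]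
  refine (setIntegral_mono_on (i1.sub i2).norm ((g3.const_mul _).add (g32.const_mul _))
    measurableSet_Ioi hpt).trans ?_
  rw [integral_add' (g3.const_mul _) (g32.const_mul _), integral_const_mul, integral_const_mul,
    integral_Ioi_rpow_of_lt (by norm_num) hη, integral_Ioi_rpow_of_lt (by norm_num) hη]
  have s1 : (1 / (q : ℝ)) ^ (-3 + 1 : ℝ) = q ^ 2 := by
    rw [one_div, Real.inv_rpow hqR.le, ← Real.rpow_neg hqR.le]; norm_num
  have s2 : (1 / (q : ℝ)) ^ (-(3 / 2) + 1 : ℝ) = √q := by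
    rw [one_div, Real.inv_rpow hqR.le, ← Real.rpow_neg hqR.le, Real.sqrt_eq_rpow]; norm_num
  rw [s1, s2]
  unfold centerConst
  have hs0 : 0 < √(q : ℝ) := Real.sqrt_pos.2 hqR
  have hss : √(q : ℝ) ^ 2 = q := Real.sq_sqrt hqR.le
  apply le_of_eq
  set s := √(q : ℝ)
  rw [← hss]
  field_simp
  ring

/-! ### Summation over the convergents -/

theorem norm_thetaMean_levels_le {p q p' q' : ℕ} (hq : 0 < q) (hqq : q' ≤ q)
    (hdet : |(p : ℤ) * q' - p' * q| = 1) {t : ℝ} (ht : Irrational t)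
    (h01 : t ∈ Set.Ioo (0 : ℝ) 1) (n : ℕ) :
    ‖thetaMean (1 / convDen q q' t (n + 1)) ((p + p' * t) / (q + q' * t)) -
      thetaMean (1 / q) ((p + p' * t) / (q + q' * t))‖ ≤
      ∑ i ∈ Finset.range n, (gaussWeight (convDen q q' t (i + 1)) / 2 *
        Real.log (cfDigit (gaussMap^[i] t)) + levelConst / √(convDen q q' t (i + 1) : ℝ)) := by
  induction n with
  | zero => simp [convDen]
  | succ n ih =>
    obtain ⟨hpos, hle, a, b, hd, hx⟩ := exists_convergent hq hqq hdet ht h01 n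
    have h := norm_thetaMean_level_le hpos hle hd (iterate_gaussMap ht h01 n).2
    rw [← hx] at h
    rw [Finset.sum_range_succ]
    exact (norm_sub_le_norm_sub_add_norm_sub _ _ _).trans ((add_le_add h ih).trans_eq (add_comm _ _))

/-- Weights dominating the rates at which the convergents following one with denominator `q`
contribute, relative to `q`; the exceptional index is that of the first even denominator. -/
noncomputable def levelWeight (c i : ℕ) : ℝ := if i = c then 1 else (3 / 4) ^ (max 1 (i / 2))

theorem levelWeight_nonneg (c i : ℕ) : 0 ≤ levelWeight c i := by
  unfold levelWeight; split_ifs <;> positivity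

theorem levelWeight_le {c i : ℕ} (h : i ≠ c) : levelWeight c i ≤ 3 / 4 := by
  unfold levelWeight
  rw [if_neg h]
  calc (3 / 4 : ℝ) ^ (max 1 (i / 2)) ≤ (3 / 4) ^ 1 :=
        pow_le_pow_of_le_one (by norm_num) (by norm_num) (le_max_left _ _)
    _ = 3 / 4 := pow_one _

theorem pow_half_le_geometric (i : ℕ) : (3 / 4 : ℝ) ^ (i / 2) ≤ 10 / 9 * (9 / 10) ^ i := by
  induction i using Nat.twoStepInduction with
  | zero => norm_num
  | one => norm_num
  | more n ih _ =>
    rw [show (n + 2) / 2 = n / 2 + 1 by omega, pow_succ, pow_add]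
    have : (0 : ℝ) < (9 / 10) ^ n := by positivity
    nlinarith

theorem sum_pow_half_le (n : ℕ) : ∑ i ∈ Finset.range n, (3 / 4 : ℝ) ^ (i / 2) ≤ 12 := by
  refine (Finset.sum_le_sum fun i _ => pow_half_le_geometric i).trans ?_
  rw [← Finset.mul_sum, geom_sum_eq (by norm_num)]
  have : (0 : ℝ) ≤ (9 / 10) ^ n := by positivity
  rw [mul_div_assoc', div_le_iff_of_neg (by norm_num)]
  linarith

theorem sum_levelWeight_le (c n : ℕ) : ∑ i ∈ Finset.range n, levelWeight c i ≤ 13 := by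
  have h : ∀ i, levelWeight c i ≤ (if i = c then 1 else 0) + (3 / 4 : ℝ) ^ (i / 2) := by
    intro i
    unfold levelWeight
    split_ifs
    · have : (0 : ℝ) ≤ (3 / 4) ^ (i / 2) := by positivity
      linarith
    · rw [zero_add]
      exact pow_le_pow_of_le_one (by norm_num) (by norm_num) (le_max_right _ _)
  refine (Finset.sum_le_sum fun i _ => h i).trans ?_
  rw [Finset.sum_add_distrib, Finset.sum_ite_eq']
  have := sum_pow_half_le n
  split_ifs <;> linarith

theorem sqrt_div_sqrt_convDen_le {q D i : ℕ} (hq : 0 < q) (h : 2 ^ (i / 2) * q ≤ D) :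
    √(q : ℝ) / √(D : ℝ) ≤ (3 / 4) ^ (i / 2) := by
  have hqR : (0 : ℝ) < q := by exact_mod_cast hq
  have hD : (2 : ℝ) ^ (i / 2) * q ≤ D := by exact_mod_cast h
  have hD0 : (0 : ℝ) < D := lt_of_lt_of_le (by positivity) hD
  rw [div_le_iff₀ (Real.sqrt_pos.2 hD0)]
  apply Real.sqrt_le_iff.2 ⟨by positivity, ?_⟩
  rw [mul_pow, Real.sq_sqrt hD0.le, ← pow_mul, mul_comm (i / 2), pow_mul]
  calc (q : ℝ) = 1 * q := (one_mul _).symm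
    _ ≤ ((9 / 16) * 2) ^ (i / 2) * q := by
        gcongr
        exact one_le_pow₀ (by norm_num)
    _ = ((3 / 4) ^ 2) ^ (i / 2) * (2 ^ (i / 2) * q) := by
        rw [mul_pow]; norm_num; ring
    _ ≤ _ := by gcongr

/-- The convergents after `p/q` contribute at most `1/√(2q)` times a weighted digit sum. -/
theorem sqrt_mul_norm_thetaMean_sub_le {p q p' q' : ℕ} (hq : 0 < q) (hqq : q' ≤ q)
    (hdet : |(p : ℤ) * q' - p' * q| = 1) {t : ℝ} (ht : Irrational t)
    (h01 : t ∈ Set.Ioo (0 : ℝ) 1) (n : ℕ) :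
    √(2 * q) * ‖thetaMean (1 / convDen q q' t (n + 1)) ((p + p' * t) / (q + q' * t)) -
      thetaMean (1 / q) ((p + p' * t) / (q + q' * t))‖ ≤
      digitSum (levelWeight (if Odd q then 1 else 0)) n t + 24 * levelConst := by
  have hqR : (0 : ℝ) < q := by exact_mod_cast hq
  have hLC : 0 ≤ levelConst := by
    have := thetaConst_nonneg
    unfold levelConst; positivity
  have h2 : √2 ≤ 3 / 2 := by rw [Real.sqrt_le_left (by norm_num)]; norm_num
  have h2sq : √2 ^ 2 = (2 : ℝ) := Real.sq_sqrt zero_le_two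
  have hweight : ∀ i, √(2 * q) * (gaussWeight (convDen q q' t (i + 1)) / 2) ≤
      levelWeight (if Odd q then 1 else 0) i := by
    intro i
    set D := convDen q q' t (i + 1) with hD
    have hgrow := two_pow_mul_le_convDen hq hqq hdet ht h01 i
    rw [← hD] at hgrow
    have hr := sqrt_div_sqrt_convDen_le hq hgrow
    have hr1 : (3 / 4 : ℝ) ^ (i / 2) ≤ 1 := pow_le_one₀ (by norm_num) (by norm_num)
    have hr0 : (0 : ℝ) ≤ (3 / 4) ^ (i / 2) := by positivity
    -- In the worst case, `D` even, the factors of `√2` cancel and `√(q/D)` remains.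
    have hgen : √(2 * q) * (gaussWeight D / 2) ≤ (3 / 4) ^ (i / 2) := by
      refine le_trans ?_ hr
      calc √(2 * q) * (gaussWeight D / 2) ≤ √(2 * q) * (√2 / √D / 2) := by
            gcongr; exact gaussWeight_le D
        _ = √2 ^ 2 * (√q / √D) / 2 := by rw [Real.sqrt_mul zero_le_two]; ring
        _ = √q / √D := by rw [h2sq]; ring
    unfold levelWeight
    rcases eq_or_ne i (if Odd q then 1 else 0) with hi | hi
    · rw [if_pos hi]
      exact hgen.trans hr1
    · rw [if_neg hi]
      rcases Nat.lt_or_ge i 2 with hlt | hge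
      · have hodd : Odd D := by
          have hor := odd_convDen_or hq hqq hdet ht h01 1
          by_cases ho : Odd q
          · rw [if_pos ho] at hi
            have : i = 0 := by omega
            rw [hD, this]
            exact ho
          · rw [if_neg ho] at hi
            have : i = 1 := by omega
            rw [hD, this]
            exact hor.resolve_left ho
        rw [max_eq_left (by omega), pow_one]
        have : gaussWeight D = 1 / √D := if_pos hodd
        rw [this, Real.sqrt_mul zero_le_two]
        calc √2 * √q * (1 / √D / 2) = √2 * (√q / √D) / 2 := by ring
          _ ≤ 3 / 2 * 1 / 2 := by
              gcongr
              exact hr.trans hr1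
          _ = 3 / 4 := by norm_num
      · rw [max_eq_right (by omega)]
        exact hgen
  have herr : ∀ i, √(2 * q) * (levelConst / √(convDen q q' t (i + 1) : ℝ)) ≤
      2 * levelConst * (3 / 4) ^ (i / 2) := by
    intro i
    have hr := sqrt_div_sqrt_convDen_le hq (two_pow_mul_le_convDen hq hqq hdet ht h01 i)
    rw [Real.sqrt_mul zero_le_two]
    calc √2 * √q * (levelConst / √(convDen q q' t (i + 1) : ℝ))
        = √2 * levelConst * (√q / √(convDen q q' t (i + 1) : ℝ)) := by ring
      _ ≤ _ := by gcongr; linarith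
  refine (mul_le_mul_of_nonneg_left (norm_thetaMean_levels_le hq hqq hdet ht h01 n)
    (Real.sqrt_nonneg _)).trans ?_
  calc √(2 * q) * ∑ i ∈ Finset.range n, (gaussWeight (convDen q q' t (i + 1)) / 2 *
        Real.log (cfDigit (gaussMap^[i] t)) + levelConst / √(convDen q q' t (i + 1) : ℝ))
      = ∑ i ∈ Finset.range n, (√(2 * q) * (gaussWeight (convDen q q' t (i + 1)) / 2) *
        Real.log (cfDigit (gaussMap^[i] t)) +
        √(2 * q) * (levelConst / √(convDen q q' t (i + 1) : ℝ))) := by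
        rw [Finset.mul_sum]
        exact Finset.sum_congr rfl fun i _ => by ring
    _ ≤ ∑ i ∈ Finset.range n, (levelWeight (if Odd q then 1 else 0) i *
        Real.log (cfDigit (gaussMap^[i] t)) + 2 * levelConst * (3 / 4) ^ (i / 2)) := by
        refine Finset.sum_le_sum fun i _ => add_le_add ?_ (herr i)
        exact mul_le_mul_of_nonneg_right (hweight i) (Real.log_natCast_nonneg _)
    _ ≤ _ := by
        rw [Finset.sum_add_distrib, ← Finset.mul_sum, digitSum]
        have := mul_le_mul_of_nonneg_left (sum_pow_half_le n)
          (show 0 ≤ 2 * levelConst by positivity)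
        linarith

theorem tendsto_one_div_convDen {p q p' q' : ℕ} (hq : 0 < q) (hqq : q' ≤ q)
    (hdet : |(p : ℤ) * q' - p' * q| = 1) {t : ℝ} (ht : Irrational t)
    (h01 : t ∈ Set.Ioo (0 : ℝ) 1) :
    Tendsto (fun n => (1 : ℝ) / convDen q q' t (n + 1)) atTop (𝓝[>] 0) := by
  have hN : Tendsto (fun n => convDen q q' t (n + 1)) atTop atTop := by
    refine tendsto_atTop_mono (f := fun n => n / 2) (fun n => ?_) (Nat.tendsto_div_const_atTop (by norm_num))
    have h := two_pow_mul_le_convDen hq hqq hdet ht h01 n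
    have h2 : n / 2 < 2 ^ (n / 2) := Nat.lt_two_pow_self
    nlinarith
  rw [tendsto_nhdsWithin_iff]
  refine ⟨?_, Eventually.of_forall fun n => ?_⟩
  · simp_rw [one_div]
    exact tendsto_inv_atTop_zero.comp (tendsto_natCast_atTop_atTop.comp hN)
  · have := (exists_convergent hq hqq hdet ht h01 n).1
    have : (0 : ℝ) < convDen q q' t (n + 1) := by exact_mod_cast this
    exact one_div_pos.2 this

noncomputable def deviationConst : ℝ := 24 * levelConst + 2 * centerConst

/-- Smoothing at `η = 1/q_n` converges to the series, so a strict deviation is already visible at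
some finite `n`. There it splits into the convergents after `p/q` and the nearly constant coarse
part, whose bounds make up `deviationConst`. -/
theorem exists_lt_digitSum {p q p' q' : ℕ} (hq : 0 < q) (hqq : q' ≤ q)
    (hdet : |(p : ℤ) * q' - p' * q| = 1) {t : ℝ} (ht : Irrational t)
    (h01 : t ∈ Set.Ioo (0 : ℝ) 1) {s : ℂ}
    (hs : Tendsto (fun N => squaresPartialSum N ((p + p' * t) / (q + q' * t))) atTop (𝓝 s))
    {lam : ℝ} (hlam : lam < ‖s - thetaMean (1 / q) (p / q)‖) :
    ∃ n, lam * √(2 * q) - deviationConst <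
      digitSum (levelWeight (if Odd q then 1 else 0)) n t := by
  set x := (p + p' * t) / (q + q' * t) with hx
  have hqR : (0 : ℝ) < q := by exact_mod_cast hq
  have ht0 := h01.1
  have hden : (0 : ℝ) < q + q' * t := by positivity
  have hlim := (tendsto_thetaMean hs).comp (tendsto_one_div_convDen hq hqq hdet ht h01)
  have hlim' := (hlim.sub_const (thetaMean (1 / q) (p / q))).norm
  obtain ⟨n, hn⟩ := (hlim'.eventually (lt_mem_nhds hlam)).exists
  refine ⟨n, ?_⟩
  have hlev := sqrt_mul_norm_thetaMean_sub_le hq hqq hdet ht h01 n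
  rw [← hx] at hlev
  have hcop : IsCoprime (p : ℤ) (q : ℤ) := by
    rcases (abs_eq zero_le_one).1 hdet with h | h
    · exact ⟨q', -p', by linarith⟩
    · exact ⟨-q', p', by linarith⟩
  have hdetR : |(p' : ℝ) * q - p * q'| = 1 := by
    rw [abs_sub_comm]; exact_mod_cast hdet
  have hdx : |x - ((p : ℤ) : ℝ) / q| ≤ 1 / (q : ℝ) ^ 2 := by
    have : x - ((p : ℤ) : ℝ) / q = (p' * q - p * q') * (t / (q * (q + q' * t))) := by
      rw [hx]; push_cast; field_simp; ring
    rw [this, abs_mul, hdetR, one_mul, abs_of_nonneg (by positivity), pow_two]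
    have : 0 ≤ q' * t := by positivity
    gcongr
    · exact h01.2.le
    · linarith
  have hcen := norm_thetaMean_sub_center_le hq hcop hdx
  rw [Int.cast_natCast] at hcen
  have hcen' : √(2 * q) * ‖thetaMean (1 / q) x - thetaMean (1 / q) (p / q)‖ ≤ 2 * centerConst := by
    have hC : 0 ≤ centerConst := by
      have := thetaConst_nonneg
      unfold centerConst; positivity
    have h2 : √2 ≤ 2 := by rw [Real.sqrt_le_left (by norm_num)]; norm_num
    have hs0 : 0 < √(q : ℝ) := Real.sqrt_pos.2 hqR
    calc √(2 * q) * _ ≤ √(2 * q) * (centerConst / √q) := by gcongr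
      _ = √2 * centerConst := by rw [Real.sqrt_mul zero_le_two]; field_simp
      _ ≤ _ := by gcongr
  have hsq : 0 < √(2 * (q : ℝ)) := by positivity
  have htri := norm_sub_le_norm_sub_add_norm_sub (thetaMean (1 / convDen q q' t (n + 1)) x)
    (thetaMean (1 / q) x) (thetaMean (1 / q) (p / q))
  simp only [Function.comp] at hn
  have := mul_lt_mul_of_pos_left (hn.trans_le htri) hsq
  unfold deviationConst
  linarith

/-! ### The deviation bound and the passage to the mean -/

theorem tendsto_squaresSeries {x : ℝ}
    (h : ∃ s : ℂ, Tendsto (fun N : ℕ => squaresPartialSum N x) atTop (𝓝 s)) :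
    Tendsto (fun N : ℕ => squaresPartialSum N x) atTop (𝓝 (squaresSeries x)) :=
  tendsto_nhds_limUnder h

theorem ae_tendsto_squaresSeries :
    ∀ᵐ x : ℝ, Tendsto (fun N : ℕ => squaresPartialSum N x) atTop (𝓝 (squaresSeries x)) := by
  filter_upwards [ae_exists_tendsto_squaresPartialSum] with x hx
  exact tendsto_squaresSeries hx

theorem aestronglyMeasurable_squaresSeries : AEStronglyMeasurable squaresSeries volume :=
  aestronglyMeasurable_of_tendsto_ae atTop
    (fun N => (continuous_squaresPartialSum N).aestronglyMeasurable) ae_tendsto_squaresSeries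

/-- The weak-type deviation bound around the value of the smoothed series at `p/q`. -/
theorem exists_volume_deviation_le : ∃ C : ℝ, 0 < C ∧ ∀ p q : ℕ, 0 < q → Nat.Coprime p q →
    ∀ a : List ℕ, (∀ k ∈ a, 0 < k) → finContFrac a = (p : ℚ) / (q : ℚ) →
    0 < volume (contFracInterval a) ∧ ∃ c : ℂ, ∀ lam : ℝ,
      volume {x | x ∈ contFracInterval a ∧ lam < ‖squaresSeries x - c‖} ≤
        ENNReal.ofReal (C * Real.exp (-lam * √(2 * q))) * volume (contFracInterval a) := by
  obtain ⟨C, hC, hbound⟩ := exists_volume_digitSum_le 13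
  refine ⟨4 * C * Real.exp deviationConst, by positivity, fun p₀ q₀ hq₀ hcop₀ a ha hfc₀ => ?_⟩
  obtain ⟨p, q, p', q', hq, hqq, -, hdet, hfc, hin, hout⟩ := exists_moebius_contFracInterval a ha
  have hcop : Nat.Coprime p q := by
    rw [← Nat.isCoprime_iff_coprime]
    rcases (abs_eq zero_le_one).1 hdet with h | h
    · exact ⟨q', -p', by linarith⟩
    · exact ⟨-q', p', by linarith⟩
  have hqeq : q = q₀ := by
    have h : (p : ℚ) / q = (p₀ : ℚ) / q₀ := hfc.symm.trans hfc₀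
    have := Rat.div_int_inj (a := p) (b := q) (c := p₀) (d := q₀) (by exact_mod_cast hq)
      (by exact_mod_cast hq₀) (by simpa using hcop) (by simpa using hcop₀) (by push_cast; exact h)
    exact_mod_cast this.2
  subst hqeq
  have hqR : (0 : ℝ) < q := by exact_mod_cast hq
  set M : ℝ → ℝ := fun t => (p + p' * t) / (q + q' * t) with hM
  have hvol : ENNReal.ofReal (1 / (4 * (q : ℝ) ^ 2)) ≤ volume (contFracInterval a) := by
    refine (le_volume_moebius_image hq hqq hdet).trans (measure_mono ?_)
    rintro _ ⟨t, ht, rfl⟩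
    exact hin t ht
  refine ⟨lt_of_lt_of_le (ENNReal.ofReal_pos.2 (by positivity)) hvol,
    thetaMean (1 / q) (p / q), fun lam => ?_⟩
  set τ := levelWeight (if Odd q then 1 else 0) with hτ
  set L := lam * √(2 * q) - deviationConst with hL
  set A : ℕ → Set ℝ := fun n => {t | t ∈ Set.Ioo (0 : ℝ) 1 ∧ L < digitSum τ n t} with hA
  have hτ0 : ∀ i, 0 ≤ τ i := levelWeight_nonneg _
  have hAmono : Monotone A := fun m n hmn t ht => ⟨ht.1, ht.2.trans_le (digitSum_mono hτ0 t hmn)⟩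
  have hAmeas : ∀ n, MeasurableSet (A n) := fun n =>
    measurableSet_Ioo.inter (measurableSet_lt measurable_const (measurable_digitSum _ _))
  have hAvol : volume (⋃ n, A n) ≤ ENNReal.ofReal (C * Real.exp (-L)) := by
    rw [hAmono.measure_iUnion]
    refine iSup_le fun n => hbound τ hτ0 (fun i => levelWeight_le (by split_ifs <;> omega)) ?_
      (sum_levelWeight_le _) n L
    by_cases ho : Odd q
    · right
      rw [hτ, if_pos ho]
      exact ⟨levelWeight_le (by omega), by simp [levelWeight]⟩
    · left
      rw [hτ, if_neg ho]
      exact ⟨by simp [levelWeight], levelWeight_le (by omega)⟩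
  -- Discarded null set: points of divergence, and rationals, whose continued fraction stops.
  set N : Set ℝ := {x | ¬ Tendsto (fun N : ℕ => squaresPartialSum N x) atTop (𝓝 (squaresSeries x))} ∪
    Set.range ((↑) : ℚ → ℝ) with hN
  have hNnull : volume N = 0 :=
    measure_union_null (ae_iff.1 ae_tendsto_squaresSeries) ((Set.countable_range _).measure_zero _)
  have hsub : {x | x ∈ contFracInterval a ∧ lam < ‖squaresSeries x - thetaMean (1 / q) (p / q)‖} ⊆
      N ∪ M '' ⋃ n, A n := by
    rintro x ⟨hx, hlam⟩
    by_cases hxN : x ∈ N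
    · exact Or.inl hxN
    right
    rw [hN, Set.mem_union, not_or, Set.mem_ofPred_eq, not_not] at hxN
    obtain ⟨t, ht, rfl⟩ := hout x hx
    have hirr : Irrational t := by
      rintro ⟨r, rfl⟩
      exact hxN.2 ⟨(p + p' * r) / (q + q' * r), by push_cast; rfl⟩
    have ht01 : t ∈ Set.Ioo (0 : ℝ) 1 := ⟨lt_of_le_of_ne ht.1 hirr.ne_zero.symm, ht.2⟩
    obtain ⟨n, hn⟩ := exists_lt_digitSum hq hqq hdet hirr ht01 hxN.1 hlam
    exact ⟨t, Set.mem_iUnion.2 ⟨n, ht01, hn⟩, rfl⟩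
  calc volume {x | x ∈ contFracInterval a ∧ lam < ‖squaresSeries x - thetaMean (1 / q) (p / q)‖}
      ≤ volume N + volume (M '' ⋃ n, A n) := (measure_mono hsub).trans (measure_union_le _ _)
    _ ≤ 0 + ENNReal.ofReal (1 / (q : ℝ) ^ 2) * volume (⋃ n, A n) := by
        rw [hNnull]
        gcongr
        exact volume_moebius_image_le hq hdet (MeasurableSet.iUnion hAmeas)
          (Set.iUnion_subset fun n t ht => ⟨ht.1.1.le, ht.1.2⟩)
    _ ≤ ENNReal.ofReal (1 / (q : ℝ) ^ 2) * ENNReal.ofReal (C * Real.exp (-L)) := by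
        rw [zero_add]; gcongr
    -- The distortion supplies the `4`, and the shift in `L` supplies `exp deviationConst`.
    _ = ENNReal.ofReal (4 * C * Real.exp deviationConst * Real.exp (-lam * √(2 * q))) *
        ENNReal.ofReal (1 / (4 * (q : ℝ) ^ 2)) := by
        rw [← ENNReal.ofReal_mul (by positivity), ← ENNReal.ofReal_mul (by positivity), hL, neg_sub,
          sub_eq_add_neg, Real.exp_add, neg_mul]
        congr 1
        field_simp
    _ ≤ _ := by gcongr

/-- Layer cake formula: the exponential tail integrates to `C/s`. -/
theorem lintegral_norm_le_of_exp_tail {f : ℝ → ℂ} {I : Set ℝ} (hf : AEStronglyMeasurable f volume)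
    {C s : ℝ} (hC : 0 ≤ C) (hs : 0 < s) (h : ∀ lam : ℝ, volume {x | x ∈ I ∧ lam < ‖f x‖} ≤
      ENNReal.ofReal (C * Real.exp (-lam * s)) * volume I) :
    ∫⁻ x in I, ‖f x‖ₑ ≤ ENNReal.ofReal (C / s) * volume I := by
  have hm : AEMeasurable (fun x => ‖f x‖) (volume.restrict I) := hf.norm.aemeasurable.restrict
  have h1 : ∫⁻ x in I, ‖f x‖ₑ = ∫⁻ x in I, ENNReal.ofReal ‖f x‖ := by
    simp_rw [ofReal_norm]
  rw [h1, lintegral_eq_lintegral_meas_lt _ (Eventually.of_forall fun x => norm_nonneg _) hm]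
  have hle : ∀ lam : ℝ, volume.restrict I {x | lam < ‖f x‖} ≤
      ENNReal.ofReal (C * Real.exp (-s * lam)) * volume I := by
    intro lam
    rw [Measure.restrict_apply₀ (nullMeasurableSet_lt aemeasurable_const hm)]
    refine le_trans (measure_mono ?_) ((h lam).trans_eq ?_)
    · exact fun x hx => ⟨hx.2, hx.1⟩
    · rw [show -lam * s = -s * lam by ring]
  refine (lintegral_mono hle).trans_eq ?_
  have hint : IntegrableOn (fun lam : ℝ => C * Real.exp (-s * lam)) (Set.Ioi 0) :=
    (integrableOn_exp_mul_Ioi (neg_lt_zero.2 hs) 0).const_mul C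
  rw [lintegral_mul_const _ (by fun_prop), ← ofReal_integral_eq_lintegral_ofReal hint
    (Eventually.of_forall fun _ => by positivity), integral_const_mul,
    integral_exp_mul_Ioi (neg_lt_zero.2 hs)]
  congr 2
  simp
  ring

theorem volume_contFracInterval_ne_top (a : List ℕ) : volume (contFracInterval a) ≠ ⊤ :=
  ne_top_of_le_ne_top (by simp) (measure_mono fun _ hx => hx.1 :
    volume (contFracInterval a) ≤ volume (Set.Ico (0 : ℝ) 1))

theorem norm_setAverage_sub_le {f : ℝ → ℂ} {I : Set ℝ} {c : ℂ} {B : ℝ} (hB : 0 ≤ B)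
    (h0 : volume I ≠ 0) (htop : volume I ≠ ⊤) (hf : IntegrableOn (fun x => f x - c) I)
    (h : ∫⁻ x in I, ‖f x - c‖ₑ ≤ ENNReal.ofReal B * volume I) :
    ‖(⨍ x in I, f x) - c‖ ≤ B := by
  have hc : IntegrableOn (fun _ => c) I := integrableOn_const htop
  have hpos : 0 < volume.real I := ENNReal.toReal_pos h0 htop
  have hfi : ∫ x in I, f x = (∫ x in I, (f x - c)) + volume.real I • c := by
    rw [← setIntegral_const c, ← integral_add hf hc]
    simp
  have hn : ‖∫ x in I, (f x - c)‖ ≤ B * volume.real I := by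
    refine (norm_integral_le_integral_norm _).trans ?_
    rw [integral_norm_eq_lintegral_enorm hf.aestronglyMeasurable]
    refine (ENNReal.toReal_mono (ENNReal.mul_ne_top ENNReal.ofReal_ne_top htop) h).trans_eq ?_
    rw [ENNReal.toReal_mul, ENNReal.toReal_ofReal hB, Measure.real]
  rw [setAverage_eq, hfi, smul_add, smul_smul, inv_mul_cancel₀ hpos.ne', one_smul,
    add_sub_cancel_right, norm_smul, norm_inv, Real.norm_of_nonneg hpos.le,
    inv_mul_le_iff₀ hpos, mul_comm]
  exact hn

theorem theorem3 :
    (∀ᵐ x : ℝ, ∃ s : ℂ, Tendsto (fun N : ℕ => squaresPartialSum N x) atTop (𝓝 s)) ∧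
    IntegrableOn squaresSeries (Set.Ico (0 : ℝ) 1) volume ∧
    ∃ C : ℝ, 0 < C ∧
      ∀ p q : ℕ, 0 < q → Nat.Coprime p q →
        ∀ a : List ℕ, (∀ k ∈ a, 0 < k) → finContFrac a = (p : ℚ) / (q : ℚ) →
          ∀ lam : ℝ, 0 < lam →
            volume.real {x : ℝ | x ∈ contFracInterval a ∧
                lam < ‖squaresSeries x - ⨍ y in contFracInterval a, squaresSeries y‖} ≤
              C * volume.real (contFracInterval a) * Real.exp (-lam * √(2 * (q : ℝ))) := by
  obtain ⟨C, hC, hdev⟩ := exists_volume_deviation_le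
  have hmeas : ∀ c : ℂ, AEStronglyMeasurable (fun x => squaresSeries x - c) volume := fun c =>
    aestronglyMeasurable_squaresSeries.sub aestronglyMeasurable_const
  have hint : ∀ a : List ℕ, ∀ c : ℂ, ∀ B : ℝ, ∫⁻ x in contFracInterval a, ‖squaresSeries x - c‖ₑ ≤
      ENNReal.ofReal B * volume (contFracInterval a) →
      IntegrableOn (fun x => squaresSeries x - c) (contFracInterval a) := fun a c B h =>
    ⟨(hmeas c).restrict, lt_of_le_of_lt h (ENNReal.mul_lt_top ENNReal.ofReal_lt_top
      (volume_contFracInterval_ne_top a).lt_top)⟩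
  refine ⟨ae_exists_tendsto_squaresPartialSum, ?_, C * Real.exp C, by positivity, ?_⟩
  -- The empty expansion of `0/1` has interval `[0,1)`, so integrability follows from the tail
  -- bound.
  · obtain ⟨-, c, hc⟩ := hdev 0 1 one_pos (by simp) [] (by simp) (by simp [finContFrac])
    have hI : contFracInterval [] = Set.Ico 0 1 := by
      ext x; simp [contFracInterval]
    have h := hint _ c _ (lintegral_norm_le_of_exp_tail (hmeas c) hC.le (by positivity) hc)
    have hc' : IntegrableOn (fun _ => c) (contFracInterval []) :=
      integrableOn_const (volume_contFracInterval_ne_top _)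
    rw [← hI]
    have := h.add hc'
    refine this.congr_fun_ae (Eventually.of_forall fun x => ?_)
    simp
  · intro p q hq hcop a ha hfc lam _
    obtain ⟨hpos, c, hc⟩ := hdev p q hq hcop a ha hfc
    set I := contFracInterval a with hI
    set s := √(2 * (q : ℝ)) with hs
    have hs0 : 0 < s := by positivity
    have hlin := lintegral_norm_le_of_exp_tail (hmeas c) hC.le hs0 hc
    have hav := norm_setAverage_sub_le (f := squaresSeries) (by positivity) hpos.ne'
      (volume_contFracInterval_ne_top a) (hint a c _ hlin) hlin
    set m := ⨍ y in I, squaresSeries y with hm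
    have hsub : {x : ℝ | x ∈ I ∧ lam < ‖squaresSeries x - m‖} ⊆
        {x | x ∈ I ∧ lam - C / s < ‖squaresSeries x - c‖} := by
      rintro x ⟨hx, hl⟩
      refine ⟨hx, ?_⟩
      have := norm_sub_le_norm_sub_add_norm_sub (squaresSeries x) c m
      rw [norm_sub_rev c m] at this
      linarith
    -- Replacing `c` by the mean lowers the level by `C/s`, which multiplies the bound by `exp C`.
    -- The lowered level may be negative; the tail bound covers all real levels.
    have hvol := (measure_mono hsub).trans (hc (lam - C / s))
    have hfin : ENNReal.ofReal (C * Real.exp (-(lam - C / s) * s)) * volume I ≠ ⊤ :=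
      ENNReal.mul_ne_top ENNReal.ofReal_ne_top (volume_contFracInterval_ne_top a)
    refine (ENNReal.toReal_mono hfin hvol).trans_eq ?_
    rw [ENNReal.toReal_mul, ENNReal.toReal_ofReal (by positivity), ← Measure.real,
      show -(lam - C / s) * s = C + -lam * s by field_simp; ring, Real.exp_add]
    ring
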